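/- **Setting.** Let $d\ge 1$, $R>0$, and let $K,K^*\subseteq B(0,R)\subseteq\mathbb R^d$ be compact, where $B(x,r)$ is the closed Euclidean ball. Let $W\subseteq\mathbb R^d$ be a convex cone (closed under multiplication by scalars $\ge 0$) with non-empty interior, and $W^\circ=\{c\in\mathbb R^d: w^\top c\ge 0\ \forall w\in W\}$. Let $\mathcal O:W\to K$ be an oracle with $v^\top\mathcal O(v)\le v^\top x^*$ for all $v\in W$, $x^*\in K^*$. A function $\varphi:\mathcal A\to\mathbb R$, $\mathcal A\subseteq\mathbb R^d$ convex, is *Legendre* if on $\mathrm{int}(\mathcal A)$ it is strictly convex and differentiable with continuous gradient, and $\|\nabla\varphi(x_n)\|\to\infty$ for every sequence $(x_n)$ in $\mathrm{int}(\mathcal A)$ converging to a boundary point of $\mathcal A$. Its Bregman divergence is $D_\varphi(x,y)=\varphi(x)-\varphi(y)-\nabla\varphi(y)^\top(x-y)$, for $x\in\mathcal A$, $y\in\mathrm{int}(\mathcal A)$. The pair $(\varphi,W)$ has the *PNIP property* if $\varphi$ is Legendre, twice differentiable on $\mathrm{int}(\mathcal A)$, and every $H$ in the convex hull of $\{\nabla^2\varphi(x):x\in\mathrm{int}(\mathcal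 A)\}$ is invertible with $w^\top H^{-1}w'\ge0$ for all $w,w'\in W$. **Algorithm** (input $y\in\mathrm{int}(\mathcal A)$, $\epsilon>0$). Put $W_1=W\cap B(0,1)$, $z_1=y$, $i=0$. While $i<5d\log\frac{2(R+\|z_{i+1}\|)}{\epsilon}$: increase $i$ by one; let $w_i=\frac1{\mathrm{vol}(W_i)}\int_{W_i}w\,\mathrm dw$ be the centroid of $W_i$ (if $\mathrm{vol}(W_i)=0$, let $w_i$ be any element of $W$); put $v_i=\mathcal O(w_i)$; let $z_{i+1}$ be a minimizer of $D_\varphi(z,z_i)$ over $z\in\mathcal A$ with $w_i^\top(z-v_i)\ge0$; put $W_{i+1}=W_i\cap\{w:w^\top(v_i-z_{i+1})\ge0\}$. When the loop ends put $k=i$, let $(p,c)$ be a solution of $\min_{p\in\Delta^{k-1},\,c\in W^\circ}\|\sum_{i=1}^kp_iv_i+c-z_{k+1}\|$, where $\Delta^{k-1}$ is the probability simplex, and return $y'=z_{k+1}$, $V=(v_1,\dots,v_k)$ and $p$. **Theorem.** Suppose that $(\varphi,W)$ has the PNIP property, that $\varphi$ is $\mu$-strongly convex on $\mathcal A$ for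 some $\mu>0$, and that $K^*\subseteq\mathcal A$ and $K^*\cap\mathrm{int}(\mathcal A)\neq\emptyset$. (If $\mathcal A=\mathbb R^d$, the last two conditions only say that $K^*\ne\emptyset$.) Then for all $y\in\mathrm{int}(\mathcal A)$ and $\epsilon\in(0,R]$: 1. The algorithm is well defined: in every execution all $z_i$ lie in $\mathrm{int}(\mathcal A)$, and as long as the loop condition holds the next iteration can be carried out ($w_i\in W$, and the required minimizer exists). 2. Every execution stops after at most $$\left\lceil 5d\log\frac{4R+2\sqrt{\frac2\mu\,\inf_{x^*\in K^*}D_\varphi(x^*,y)}}{\epsilon}\right\rceil$$ iterations (the infimum is a minimum if, for instance, $K^*\subseteq\mathrm{int}(\mathcal A)$). 3. When the algorithm has stopped, an optimal $p$ exists, and for every such $p$ the output $(y',V,p)$ satisfies: $D_\varphi(x^*,y')\le D_\varphi(x^*,y)$ for all $x^*\in K^*$; $v_1,\dots,v_k\in K$ and $p\in\Delta^{k-1}$; and there is $c\in W^\circ$ with $\bigl\|\sum_{i=1}^kp_iv_i+c-y'\bigr\|\le\epsilon$. -/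

import Mathlib

open Set Filter Topology MeasureTheory
open scoped Gradient InnerProductSpace

noncomputable section

namespace PAD

/-- Legendre functions `φ : A → ℝ`, `A ⊆ ℝᵈ`; the values of `φ` outside `A` play no role. -/
structure IsLegendre {d : ℕ} (A : Set (EuclideanSpace ℝ (Fin d)))
    (φ : EuclideanSpace ℝ (Fin d) → ℝ) : Prop where
  convex_dom : Convex ℝ A
  strictConvexOn : StrictConvexOn ℝ (interior A) φ
  differentiableOn : DifferentiableOn ℝ φ (interior A)
  continuousOn_gradient : ContinuousOn (∇ φ) (interior A)
  steep : ∀ (x : ℕ → EuclideanSpace ℝ (Fin d)) (a : EuclideanSpace ℝ (Fin d)),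
    (∀ n, x n ∈ interior A) → a ∈ frontier A → Tendsto x atTop (𝓝 a) →
      Tendsto (fun n => ‖∇ φ (x n)‖) atTop atTop

/-- The Bregman divergence `D_φ(x, y) = φ(x) - φ(y) - ∇φ(y)ᵀ(x - y)`. -/
def bregman {d : ℕ} (φ : EuclideanSpace ℝ (Fin d) → ℝ) (x y : EuclideanSpace ℝ (Fin d)) : ℝ :=
  φ x - φ y - ⟪∇ φ y, x - y⟫_ℝ

/-- The Hessian of `φ` at `x`, as the linear operator `h ↦ ∇²φ(x) h`. -/
def hessian {d : ℕ} (φ : EuclideanSpace ℝ (Fin d) → ℝ) (x : EuclideanSpace ℝ (Fin d)) :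
    EuclideanSpace ℝ (Fin d) →L[ℝ] EuclideanSpace ℝ (Fin d) :=
  fderiv ℝ (∇ φ) x

/-- The pairwise non-negative inner product property of `(φ, W)`: `φ` is a twice-differentiable
Legendre function on `A`, and `wᵀ H⁻¹ w' ≥ 0` for all `w, w' ∈ W` and all `H` in the convex hull
of the Hessians of `φ` (which have to be invertible for this to make sense). -/
structure PNIP {d : ℕ} (A : Set (EuclideanSpace ℝ (Fin d))) (φ : EuclideanSpace ℝ (Fin d) → ℝ)
    (W : PointedCone ℝ (EuclideanSpace ℝ (Fin d))) : Prop where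
  legendre : IsLegendre A φ
  twice_differentiable : DifferentiableOn ℝ (∇ φ) (interior A)
  invertible : ∀ H ∈ convexHull ℝ (hessian φ '' interior A), H.IsInvertible
  nonneg : ∀ H ∈ convexHull ℝ (hessian φ '' interior A), ∀ w ∈ W, ∀ w' ∈ W,
    0 ≤ ⟪w, H.inverse w'⟫_ℝ

/-- `O : W → K` is an improper linear optimization oracle:
`vᵀ O(v) ≤ min_{x ∈ Kstar} vᵀ x` for all `v ∈ W`. -/
def IsImproperOracle {d : ℕ} (K Kstar : Set (EuclideanSpace ℝ (Fin d)))
    (W : PointedCone ℝ (EuclideanSpace ℝ (Fin d))) (O : W → EuclideanSpace ℝ (Fin d)) : Prop :=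
  ∀ v : W, O v ∈ K ∧ ∀ x ∈ Kstar, ⟪(v : EuclideanSpace ℝ (Fin d)), O v⟫_ℝ
    ≤ ⟪(v : EuclideanSpace ℝ (Fin d)), x⟫_ℝ

/-- The two requirements on an output `(y', (v₁, …, v_k), p)` of a projection-and-decomposition
oracle onto `Kstar` on input `y, ε, W, φ`, together with `p ∈ Δ^{k-1}`. The dual cone `W°` is
`ProperCone.innerDual W`. -/
structure IsPADOutput {d : ℕ} (K Kstar : Set (EuclideanSpace ℝ (Fin d)))
    (W : PointedCone ℝ (EuclideanSpace ℝ (Fin d))) (φ : EuclideanSpace ℝ (Fin d) → ℝ)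
    (y : EuclideanSpace ℝ (Fin d)) (ε : ℝ) (y' : EuclideanSpace ℝ (Fin d)) {k : ℕ}
    (v : Fin k → EuclideanSpace ℝ (Fin d)) (p : Fin k → ℝ) : Prop where
  weights : p ∈ stdSimplex ℝ (Fin k)
  closer : ∀ x ∈ Kstar, bregman φ x y' ≤ bregman φ x y
  mem : ∀ i, v i ∈ K
  dominates : ∃ c ∈ ProperCone.innerDual (W : Set (EuclideanSpace ℝ (Fin d))),
    ‖∑ i, p i • v i + c - y'‖ ≤ ε

/-- The state of the algorithm after `i` passes through its loop: the oracle outputs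
`vs = [v₁, …, vᵢ]`, the set `S = W_{i+1}` and the point `z = z_{i+1}`. -/
structure State (d : ℕ) where
  vs : List (EuclideanSpace ℝ (Fin d))
  S : Set (EuclideanSpace ℝ (Fin d))
  z : EuclideanSpace ℝ (Fin d)

/-- `W₁ = W ∩ B(0, 1)`, `z₁ = y`. -/
def State.init {d : ℕ} (W : PointedCone ℝ (EuclideanSpace ℝ (Fin d)))
    (y : EuclideanSpace ℝ (Fin d)) : State d where
  vs := []
  S := (W : Set (EuclideanSpace ℝ (Fin d))) ∩ Metric.closedBall 0 1
  z := y

/-- The loop condition `i < 5 d log (2 (R + ‖z_{i+1}‖) / ε)`. -/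
def State.Continues {d : ℕ} (R ε : ℝ) (s : State d) : Prop :=
  (s.vs.length : ℝ) < 5 * d * Real.log (2 * (R + ‖s.z‖) / ε)

/-- The centroid `(∫_S w dw) / vol(S)`. -/
def centroid {d : ℕ} (S : Set (EuclideanSpace ℝ (Fin d))) : EuclideanSpace ℝ (Fin d) :=
  (volume.real S)⁻¹ • ∫ w in S, w

/-- `z'` minimizes `D_φ(·, z)` over the points `u` of the domain `A` with `wᵀ(u - v) ≥ 0`. -/
def IsBregmanProj {d : ℕ} (A : Set (EuclideanSpace ℝ (Fin d))) (φ : EuclideanSpace ℝ (Fin d) → ℝ)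
    (w v z z' : EuclideanSpace ℝ (Fin d)) : Prop :=
  z' ∈ {u ∈ A | 0 ≤ ⟪w, u - v⟫_ℝ} ∧
    IsMinOn (fun u => bregman φ u z) {u ∈ A | 0 ≤ ⟪w, u - v⟫_ℝ} z'

/-- One pass through the loop. The query point `w ∈ W` is the centroid of the current set; once
that set has volume zero, so that the centroid is not defined, any `w ∈ W` may be used. -/
structure Step {d : ℕ} (A : Set (EuclideanSpace ℝ (Fin d))) (φ : EuclideanSpace ℝ (Fin d) → ℝ)
    (W : PointedCone ℝ (EuclideanSpace ℝ (Fin d))) (O : W → EuclideanSpace ℝ (Fin d))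
    (R ε : ℝ) (s s' : State d) : Prop where
  continues : s.Continues R ε
  body : ∃ w : W, (volume s.S ≠ 0 → (w : EuclideanSpace ℝ (Fin d)) = centroid s.S) ∧
    s'.vs = s.vs ++ [O w] ∧
    IsBregmanProj A φ w (O w) s.z s'.z ∧
    s'.S = s.S ∩ {u | 0 ≤ ⟪u, O w - s'.z⟫_ℝ}

/-- `s` occurs in some execution of the algorithm on input `y`. -/
def Reachable {d : ℕ} (A : Set (EuclideanSpace ℝ (Fin d))) (φ : EuclideanSpace ℝ (Fin d) → ℝ)
    (W : PointedCone ℝ (EuclideanSpace ℝ (Fin d))) (O : W → EuclideanSpace ℝ (Fin d))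
    (R ε : ℝ) (y : EuclideanSpace ℝ (Fin d)) (s : State d) : Prop :=
  Relation.ReflTransGen (Step A φ W O R ε) (State.init W y) s

/-- `p` is (the first part of) a solution of
`min_{p ∈ Δ^{k-1}, c ∈ W°} ‖∑ᵢ pᵢ vᵢ + c - z‖`. -/
def IsOptimalWeights {d : ℕ} (W : PointedCone ℝ (EuclideanSpace ℝ (Fin d)))
    (z : EuclideanSpace ℝ (Fin d)) {k : ℕ} (v : Fin k → EuclideanSpace ℝ (Fin d))
    (p : Fin k → ℝ) : Prop :=
  p ∈ stdSimplex ℝ (Fin k) ∧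
    ∃ c ∈ ProperCone.innerDual (W : Set (EuclideanSpace ℝ (Fin d))),
      ∀ q ∈ stdSimplex ℝ (Fin k),
        ∀ b ∈ ProperCone.innerDual (W : Set (EuclideanSpace ℝ (Fin d))),
          ‖∑ i, p i • v i + c - z‖ ≤ ‖∑ i, q i • v i + b - z‖

end PAD

end

/-! The loop is a centre-of-gravity cutting-plane search for a certificate that z is far from being
dominated by the convex hull of the v_i. If the distance from z to conv(v_i) + W° exceeds ε, the
unit vector w from z towards the nearest point lies in the closure of W, by duality of cones, and
⟨w, v_i - z⟩ > ε for all i (`exists_separating_direction`). Mixing w with a copy of W ∩ B(0,1)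
scaled by δ = ε / (2(R + ‖z‖)) keeps these products non-negative, so the certificates fill at least
a fraction δ^d of the volume of W ∩ B(0,1) (`pow_mul_volume_le`).

On the other hand each query w is the centroid of the current set, and feasibility of the projection
z' says ⟨w, O w - z'⟩ ≤ 0. By Grünbaum's inequality every non-degenerate cut therefore removes a
fraction at least 1/e of the volume. After 5 d log(1/δ) cuts less than δ^d is left, a contradiction.

The difficulty is that z moves, while old cuts were made at old positions. Here PNIP enters:
optimality makes ∇φ z' - ∇φ z a non-negative multiple of w, a mean value argument gives z' - z ≈ c
H⁻¹ w, and hence ⟨u, z' - z⟩ ≥ 0 for all u in W (`PNIP.inner_sub_nonneg`). So ⟨u, v - z⟩ can only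
decrease for an old v, and every certificate for the current z has survived all earlier cuts.

Each move is a Bregman projection onto a half-space containing K*, so divergences from points of K*
never increase; with strong convexity this bounds ‖z‖ and thus the number of iterations. Steepness
keeps the projections in the interior. Grünbaum's inequality comes from Prékopa-Leindler via
log-concavity of cap volumes. -/

noncomputable section

namespace PAD

open scoped ENNReal Pointwise

/-! ### Brunn-Minkowski and Prékopa-Leindler inequalities -/

/-- One-dimensional Brunn-Minkowski inequality. -/
theorem volume_add_le_of_isCompact {A B C : Set ℝ} (hA : IsCompact A) (hB : IsCompact B)
    (hA' : A.Nonempty) (hB' : B.Nonempty) (h : ∀ x ∈ A, ∀ y ∈ B, x + y ∈ C) :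
    volume A + volume B ≤ volume C := by
  obtain ⟨p, hpA, hp⟩ := hA.exists_isGreatest hA'
  obtain ⟨q, hqB, hq⟩ := hB.exists_isLeast hB'
  have h1 : q +ᵥ A ⊆ C := by
    rintro _ ⟨x, hx, rfl⟩
    simpa [add_comm] using h x hx q hqB
  have h2 : p +ᵥ B ⊆ C := by
    rintro _ ⟨x, hx, rfl⟩
    simpa using h p hpA x hx
  have h3 : AEDisjoint volume (q +ᵥ A) (p +ᵥ B) := by
    refine measure_mono_null (t := {p + q}) ?_ (by simp)
    rintro _ ⟨⟨x, hx, rfl⟩, ⟨z, hz, hxz⟩⟩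
    have := hp hx
    have := hq hz
    simp only [vadd_eq_add, mem_singleton_iff] at hxz ⊢
    linarith
  have hm : MeasurableSet (p +ᵥ B) := hB.measurableSet.const_vadd p
  calc volume A + volume B = volume (q +ᵥ A) + volume (p +ᵥ B) := by
        rw [measure_vadd, measure_vadd]
    _ = volume ((q +ᵥ A) ∪ (p +ᵥ B)) := (measure_union₀ hm.nullMeasurableSet h3).symm
    _ ≤ volume C := measure_mono (union_subset h1 h2)

theorem volume_add_le {A B C : Set ℝ} (hA : MeasurableSet A) (hB : MeasurableSet B)
    (hA' : A.Nonempty) (hB' : B.Nonempty) (h : ∀ x ∈ A, ∀ y ∈ B, x + y ∈ C) :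
    volume A + volume B ≤ volume C := by
  have key : ∀ K ⊆ A, IsCompact K → ∀ L ⊆ B, IsCompact L → volume K + volume L ≤ volume C := by
    intro K hKA hK L hLB hL
    obtain ⟨x, hx⟩ := hA'
    obtain ⟨y, hy⟩ := hB'
    -- The approximating compact sets may be empty, so a point of `A` and a point of `B` are added
    -- to them.
    refine le_trans ?_ (volume_add_le_of_isCompact (hK.insert x) (hL.insert y) ⟨x, by simp⟩
      ⟨y, by simp⟩ fun u hu v hv => h u ?_ v ?_)
    · gcongr <;> simp
    · exact insert_subset hx hKA hu
    · exact insert_subset hy hLB hv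
  rw [hA.measure_eq_iSup_isCompact, hB.measure_eq_iSup_isCompact]
  simp only [iSup_and']
  exact ENNReal.biSup_add_biSup_le' ⟨∅, by simp⟩ ⟨∅, by simp⟩
    fun K hK L hL => key K hK.1 hK.2 L hL.1 hL.2

theorem volume_convexComb_le {A B C : Set ℝ} (hA : MeasurableSet A) (hB : MeasurableSet B)
    (hA' : A.Nonempty) (hB' : B.Nonempty) {a b : ℝ} (ha : 0 < a) (hb : 0 < b)
    (h : ∀ x ∈ A, ∀ y ∈ B, a * x + b * y ∈ C) :
    ENNReal.ofReal a * volume A + ENNReal.ofReal b * volume B ≤ volume C := by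
  have h1 := volume_add_le (C := C) (hA.const_smul₀ a) (hB.const_smul₀ b) hA'.smul_set hB'.smul_set
    (by rintro _ ⟨x, hx, rfl⟩ _ ⟨y, hy, rfl⟩; exact h x hx y hy)
  simpa [Measure.addHaar_smul, abs_of_pos ha, abs_of_pos hb] using h1

theorem lintegral_ofReal_eq_Ioo {F : ℝ → ℝ} (hF : Measurable F) (hF0 : ∀ x, 0 ≤ F x)
    (hF1 : ∀ x, F x ≤ 1) :
    ∫⁻ x, ENNReal.ofReal (F x) = ∫⁻ t in Ioo (0 : ℝ) 1, volume {x | t < F x} := by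
  rw [lintegral_eq_lintegral_meas_lt volume (.of_forall hF0) hF.aemeasurable]
  rw [← Ioo_union_Ici_eq_Ioi zero_lt_one, lintegral_union measurableSet_Ici]
  · rw [setLIntegral_congr_fun (g := fun _ => 0) measurableSet_Ici]
    · simp
    · intro t ht
      have : {x | t < F x} = ∅ := by
        ext x
        simpa using (hF1 x).trans ht
      simp [this]
  · rw [Set.disjoint_left]
    intro x hx hx'
    exact absurd hx.2 (not_lt.2 hx')

/-- Layer-cake integration of one-dimensional Brunn-Minkowski over the levels in (0, 1). `hFs` and
`hGs` supply the non-empty level sets without which that inequality fails. -/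
theorem lintegral_convexComb_le {F G H : ℝ → ℝ} (hF : Measurable F) (hG : Measurable G)
    (hH : Measurable H) (hF0 : ∀ x, 0 ≤ F x) (hF1 : ∀ x, F x ≤ 1) (hG0 : ∀ x, 0 ≤ G x)
    (hG1 : ∀ x, G x ≤ 1) (hH0 : ∀ x, 0 ≤ H x) (hH1 : ∀ x, H x ≤ 1)
    (hFs : ∀ t < 1, ∃ x, t < F x) (hGs : ∀ t < 1, ∃ x, t < G x) {a b : ℝ} (ha : 0 < a)
    (hb : 0 < b) (h : ∀ t x y, 0 < t → t < F x → t < G y → t < H (a * x + b * y)) :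
    ENNReal.ofReal a * (∫⁻ x, ENNReal.ofReal (F x)) +
      ENNReal.ofReal b * (∫⁻ x, ENNReal.ofReal (G x)) ≤ ∫⁻ x, ENNReal.ofReal (H x) := by
  rw [lintegral_ofReal_eq_Ioo hF hF0 hF1, lintegral_ofReal_eq_Ioo hG hG0 hG1,
    lintegral_ofReal_eq_Ioo hH hH0 hH1]
  have hm : ∀ {F : ℝ → ℝ}, Measurable fun t => volume {x | t < F x} := fun {F} =>
    Antitone.measurable fun s t hst => measure_mono fun x hx => hst.trans_lt hx
  rw [← lintegral_const_mul _ hm, ← lintegral_const_mul _ hm, ← lintegral_add_left (hm.const_mul _)]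
  refine setLIntegral_mono hm fun t ht => ?_
  exact volume_convexComb_le (hF measurableSet_Ioi) (hG measurableSet_Ioi) (hFs t ht.2)
    (hGs t ht.2) ha hb fun x hx y hy => h t x y ht.1 hx hy

theorem rpow_mul_rpow_le_add {x y : ℝ≥0∞} {a b : ℝ} (ha : 0 < a) (hb : 0 < b)
    (hab : a + b = 1) : x ^ a * y ^ b ≤ ENNReal.ofReal a * x + ENNReal.ofReal b * y := by
  by_cases hx : x = ∞
  · simp [hx, ENNReal.mul_top, ha]
  by_cases hy : y = ∞
  · simp [hy, ENNReal.mul_top, hb]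
  lift x to NNReal using hx
  lift y to NNReal using hy
  have := NNReal.geom_mean_le_arith_mean2_weighted ⟨a, ha.le⟩ ⟨b, hb.le⟩ x y (Subtype.ext hab)
  rw [← ENNReal.coe_rpow_of_nonneg _ ha.le, ← ENNReal.coe_rpow_of_nonneg _ hb.le]
  rw [ENNReal.ofReal_eq_coe_nnreal ha.le, ENNReal.ofReal_eq_coe_nnreal hb.le]
  exact_mod_cast this

/-- The Prékopa-Leindler inequality holds on the measure space `E`. -/
def HasPrekopaLeindler (E : Type*) [MeasureSpace E] [AddCommGroup E] [Module ℝ E] : Prop :=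
  ∀ (f g h : E → ℝ≥0∞), Measurable f → Measurable g → Measurable h →
    ∀ a b : ℝ, 0 < a → 0 < b → a + b = 1 → (∀ x y, f x ^ a * g y ^ b ≤ h (a • x + b • y)) →
      (∫⁻ x, f x) ^ a * (∫⁻ x, g x) ^ b ≤ ∫⁻ x, h x

/-- Dividing f and g by their suprema makes all level sets below 1 non-empty, so the arithmetic-mean
form applies; weighted AM-GM then gives the geometric one. Boundedness keeps the suprema finite. -/
theorem prekopaLeindler_real_of_bounded {f g h : ℝ → ℝ≥0∞} (hf : Measurable f)
    (hg : Measurable g) (hh : Measurable h) {C : ℝ≥0∞} (hC : C ≠ ∞) (hfC : ∀ x, f x ≤ C)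
    (hgC : ∀ x, g x ≤ C) {a b : ℝ} (ha : 0 < a) (hb : 0 < b) (hab : a + b = 1)
    (hfgh : ∀ x y, f x ^ a * g y ^ b ≤ h (a • x + b • y)) :
    (∫⁻ x, f x) ^ a * (∫⁻ x, g x) ^ b ≤ ∫⁻ x, h x := by
  set M := ⨆ x, f x with hM
  set N := ⨆ x, g x with hN
  have hMt : M ≠ ∞ := ((iSup_le hfC).trans_lt hC.lt_top).ne
  have hNt : N ≠ ∞ := ((iSup_le hgC).trans_lt hC.lt_top).ne
  rcases eq_or_ne M 0 with hM0 | hM0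
  · have : ∀ x, f x = 0 := by simpa [hM, ENNReal.iSup_eq_zero] using hM0
    simp [this, ha]
  rcases eq_or_ne N 0 with hN0 | hN0
  · have : ∀ x, g x = 0 := by simpa [hN, ENNReal.iSup_eq_zero] using hN0
    simp [this, hb]
  set L := M ^ a * N ^ b with hL
  have hLt : L ≠ ∞ := ENNReal.mul_ne_top (ENNReal.rpow_ne_top_of_nonneg ha.le hMt)
    (ENNReal.rpow_ne_top_of_nonneg hb.le hNt)
  have hL0 : L ≠ 0 := mul_ne_zero (by simp [hM0, hMt, ha]) (by simp [hN0, hNt, hb])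
  have hle : ∀ {u v : ℝ≥0∞}, v ≠ 0 → v ≠ ∞ → u ≤ v → u / v ≤ 1 := fun hv hv' huv =>
    ENNReal.div_le_of_le_mul (by simpa using huv)
  have hto : ∀ {u : ℝ≥0∞}, u ≤ 1 → ENNReal.ofReal u.toReal = u := fun hu =>
    ENNReal.ofReal_toReal (hu.trans_lt ENNReal.one_lt_top).ne
  have hlt : ∀ {t : ℝ} {u : ℝ≥0∞}, 0 < t → u ≤ 1 → (t < u.toReal ↔ ENNReal.ofReal t < u) :=
    fun ht hu => (ENNReal.ofReal_lt_iff_lt_toReal ht.le (hu.trans_lt ENNReal.one_lt_top).ne).symm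
  have hfM : ∀ x, f x / M ≤ 1 := fun x => hle hM0 hMt (le_iSup f x)
  have hgN : ∀ x, g x / N ≤ 1 := fun x => hle hN0 hNt (le_iSup g x)
  have hhL : ∀ x, min (h x / L) 1 ≤ 1 := fun x => min_le_right _ _
  have hone : ∀ {u : ℝ≥0∞}, u ≤ 1 → u.toReal ≤ 1 := fun hu => by
    simpa using ENNReal.toReal_mono ENNReal.one_ne_top hu
  have hsup : ∀ {f : ℝ → ℝ≥0∞}, (⨆ x, f x) ≠ 0 → (⨆ x, f x) ≠ ∞ →
      ∀ t < 1, ∃ x, t < (f x / ⨆ x, f x).toReal := by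
    intro f h0 h1 t ht
    have : ENNReal.ofReal (max t 0) * (⨆ x, f x) < ⨆ x, f x := by
      conv_rhs => rw [← one_mul (⨆ x, f x)]
      exact ENNReal.mul_lt_mul_left h0 h1 (by simpa using ht)
    obtain ⟨x, hx⟩ := lt_iSup_iff.1 this
    refine ⟨x, (le_max_left t 0).trans_lt ?_⟩
    rw [← ENNReal.ofReal_lt_iff_lt_toReal (le_max_right _ _)
      ((hle h0 h1 (le_iSup f x)).trans_lt ENNReal.one_lt_top).ne,
      ENNReal.lt_div_iff_mul_lt (.inl h0) (.inl h1)]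
    exact hx
  have key := lintegral_convexComb_le (F := fun x => (f x / M).toReal)
    (G := fun x => (g x / N).toReal) (H := fun x => (min (h x / L) 1).toReal)
    (hf.div_const _).ennreal_toReal (hg.div_const _).ennreal_toReal
    ((hh.div_const _).min measurable_const).ennreal_toReal (fun _ => ENNReal.toReal_nonneg)
    (fun x => hone (hfM x)) (fun _ => ENNReal.toReal_nonneg) (fun x => hone (hgN x))
    (fun _ => ENNReal.toReal_nonneg) (fun x => hone (hhL x)) (hsup hM0 hMt) (hsup hN0 hNt) ha hb
    (by
      intro t x y ht hx hy
      rw [hlt ht (hfM x)] at hx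
      rw [hlt ht (hgN y)] at hy
      rw [hlt ht (hhL _), lt_min_iff]
      refine ⟨?_, hx.trans_le (hfM x)⟩
      rw [ENNReal.lt_div_iff_mul_lt (.inl hL0) (.inl hLt)]
      rw [ENNReal.lt_div_iff_mul_lt (.inl hM0) (.inl hMt)] at hx
      rw [ENNReal.lt_div_iff_mul_lt (.inl hN0) (.inl hNt)] at hy
      refine lt_of_lt_of_le ?_ (hfgh x y)
      have e : ENNReal.ofReal t * L
          = (ENNReal.ofReal t * M) ^ a * (ENNReal.ofReal t * N) ^ b := by
        rw [ENNReal.mul_rpow_of_nonneg _ _ ha.le, ENNReal.mul_rpow_of_nonneg _ _ hb.le]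
        have : ENNReal.ofReal t = ENNReal.ofReal t ^ a * ENNReal.ofReal t ^ b := by
          rw [← ENNReal.rpow_add _ _ (by simpa using ht) ENNReal.ofReal_ne_top, hab,
            ENNReal.rpow_one]
        conv_lhs => rw [this, hL]
        ring
      rw [e]
      exact ENNReal.mul_lt_mul (ENNReal.rpow_lt_rpow hx ha) (ENNReal.rpow_lt_rpow hy hb))
  simp only [hto (hfM _), hto (hgN _), hto (hhL _)] at key
  simp only [div_eq_mul_inv] at key
  rw [lintegral_mul_const _ hf, lintegral_mul_const _ hg] at key
  have h2 : ∫⁻ x, min (h x * L⁻¹) 1 ≤ (∫⁻ x, h x) * L⁻¹ := by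
    rw [← lintegral_mul_const _ hh]
    exact lintegral_mono fun x => min_le_left _ _
  have h3 := (rpow_mul_rpow_le_add ha hb hab).trans (key.trans h2)
  rw [ENNReal.mul_rpow_of_nonneg _ _ ha.le, ENNReal.mul_rpow_of_nonneg _ _ hb.le,
    mul_mul_mul_comm, ENNReal.inv_rpow, ENNReal.inv_rpow, ← ENNReal.mul_inv
      (by simp [hM0, hMt, ha]) (by simp [hM0, hMt, ha])] at h3
  exact (ENNReal.mul_le_mul_iff_left (ENNReal.inv_ne_zero.2 hLt) (ENNReal.inv_ne_top.2 hL0)).1 h3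

theorem hasPrekopaLeindler_real : HasPrekopaLeindler ℝ := by
  intro f g h hf hg hh a b ha hb hab hfgh
  have hmono : ∀ (f : ℝ → ℝ≥0∞), Monotone fun (n : ℕ) x => min (f x) n := fun f m n hmn x =>
    min_le_min le_rfl (by exact_mod_cast hmn)
  have hlim : ∀ {f : ℝ → ℝ≥0∞}, Measurable f →
      Tendsto (fun n : ℕ => ∫⁻ x, min (f x) n) atTop (𝓝 (∫⁻ x, f x)) := by
    intro f hf
    refine lintegral_tendsto_of_tendsto_of_monotone
      (fun n => (hf.min measurable_const).aemeasurable) (.of_forall fun x m n hmn => hmono f hmn x)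
      (.of_forall fun x => ?_)
    simpa using tendsto_const_nhds.min (f := fun _ : ℕ => f x) ENNReal.tendsto_nat_nhds_top
  -- Multiplication in `ℝ≥0∞` is discontinuous at (0, ∞), so zero integrals are excluded before
  -- passing to the limit.
  rcases eq_or_ne (∫⁻ x, f x) 0 with hf0 | hf0
  · simp [hf0, ha]
  rcases eq_or_ne (∫⁻ x, g x) 0 with hg0 | hg0
  · simp [hg0, hb]
  refine le_of_tendsto (ENNReal.Tendsto.mul ((hlim hf).ennrpow_const a) (.inl ?_)
    ((hlim hg).ennrpow_const b) (.inl ?_)) (.of_forall fun n => ?_)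
  · simp [ha.le, ha, hf0]
  · simp [hb.le, hb, hg0]
  · refine prekopaLeindler_real_of_bounded (hf.min measurable_const) (hg.min measurable_const) hh
      (ENNReal.natCast_ne_top n) (fun x => min_le_right _ _) (fun x => min_le_right _ _) ha hb hab
      fun x y => le_trans ?_ (hfgh x y)
    gcongr <;> exact min_le_left _ _

/-- The inequality on `F`, applied to sections, is exactly the hypothesis needed on `E` for the
partial integrals. -/
theorem HasPrekopaLeindler.prod {E F : Type*} [MeasureSpace E] [AddCommGroup E] [Module ℝ E]
    [MeasureSpace F] [AddCommGroup F] [Module ℝ F] [SFinite (volume : Measure F)]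
    [SFinite (volume : Measure E)]
    (hE : HasPrekopaLeindler E) (hF : HasPrekopaLeindler F) : HasPrekopaLeindler (E × F) := by
  intro f g h hf hg hh a b ha hb hab hfgh
  rw [Measure.volume_eq_prod, lintegral_prod _ hf.aemeasurable, lintegral_prod _ hg.aemeasurable,
    lintegral_prod _ hh.aemeasurable]
  refine hE _ _ _ hf.lintegral_prod_right' hg.lintegral_prod_right' hh.lintegral_prod_right' a b
    ha hb hab fun x y => ?_
  exact hF _ _ _ (hf.comp measurable_prodMk_left) (hg.comp measurable_prodMk_left)
    (hh.comp measurable_prodMk_left) a b ha hb hab fun u v => hfgh (x, u) (y, v)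

theorem HasPrekopaLeindler.of_linearEquiv {E F : Type*} [MeasureSpace E] [AddCommGroup E]
    [Module ℝ E] [MeasureSpace F] [AddCommGroup F] [Module ℝ F] (hE : HasPrekopaLeindler E)
    (e : E → F) (he : MeasurePreserving e) (hadd : ∀ (a b : ℝ) x y,
      e (a • x + b • y) = a • e x + b • e y) : HasPrekopaLeindler F := by
  intro f g h hf hg hh a b ha hb hab hfgh
  rw [← he.lintegral_comp hf, ← he.lintegral_comp hg, ← he.lintegral_comp hh]
  exact hE _ _ _ (hf.comp he.measurable) (hg.comp he.measurable) (hh.comp he.measurable) a b ha hb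
    hab fun x y => by simpa [hadd] using hfgh (e x) (e y)

theorem hasPrekopaLeindler_pi (n : ℕ) : HasPrekopaLeindler (Fin n → ℝ) := by
  induction n with
  | zero =>
    intro f g h hf hg hh a b ha hb hab hfgh
    have hv : volume (univ : Set (Fin 0 → ℝ)) = 1 := by simp [volume_pi]
    rw [lintegral_unique, lintegral_unique, lintegral_unique, hv, mul_one, mul_one, mul_one]
    convert hfgh default default
  | succ n ih =>
    refine (hasPrekopaLeindler_real.prod ih).of_linearEquiv
      (MeasurableEquiv.piFinSuccAbove (fun _ => ℝ) 0).symm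
      (volume_preserving_piFinSuccAbove (fun _ : Fin (n + 1) => ℝ) 0).symm fun a b x y => ?_
    ext i
    refine Fin.cases ?_ (fun i => ?_) i <;>
      simp [MeasurableEquiv.piFinSuccAbove_symm_apply, Fin.insertNthEquiv]

theorem hasPrekopaLeindler_euclideanSpace (n : ℕ) :
    HasPrekopaLeindler (EuclideanSpace ℝ (Fin n)) :=
  (hasPrekopaLeindler_pi n).of_linearEquiv (WithLp.toLp 2) (PiLp.volume_preserving_toLp _)
    fun _ _ _ _ => rfl

/-- Multiplicative Brunn-Minkowski inequality. -/
theorem volume_rpow_mul_rpow_le {n : ℕ} {A B C : Set (EuclideanSpace ℝ (Fin n))}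
    (hA : MeasurableSet A) (hB : MeasurableSet B) (hC : MeasurableSet C) {a b : ℝ} (ha : 0 < a)
    (hb : 0 < b) (hab : a + b = 1) (h : ∀ x ∈ A, ∀ y ∈ B, a • x + b • y ∈ C) :
    volume A ^ a * volume B ^ b ≤ volume C := by
  have := hasPrekopaLeindler_euclideanSpace n (A.indicator 1) (B.indicator 1) (C.indicator 1)
    (measurable_one.indicator hA) (measurable_one.indicator hB) (measurable_one.indicator hC)
    a b ha hb hab fun x y => by
      by_cases hx : x ∈ A
      · by_cases hy : y ∈ B
        · simp [hx, hy, h x hx y hy]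
        · simp [hy, hb]
      · simp [hx, ha]
  simpa [lintegral_indicator_one, hA, hB, hC] using this

/-! ### Centroids and Grünbaum's inequality -/

theorem _root_.ConvexOn.exists_supporting_slope {D : Set ℝ} {g : ℝ → ℝ} (hg : ConvexOn ℝ D g)
    {x : ℝ} (hx : x ∈ interior D) : ∃ m : ℝ, ∀ y ∈ D, g x + m * (y - x) ≤ g y := by
  refine ⟨derivWithin g (Ioi x) x, fun y hy => ?_⟩
  rcases lt_trichotomy y x with h | rfl | h
  · have h1 := (hg.slope_le_leftDeriv_of_mem_interior hy hx h).trans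
      (hg.leftDeriv_le_rightDeriv_of_mem_interior hx)
    rw [slope_def_field, div_le_iff₀ (sub_pos.2 h)] at h1
    linarith
  · simp
  · have h1 := hg.rightDeriv_le_slope_of_mem_interior hx hy h
    rw [slope_def_field, le_div_iff₀ (sub_pos.2 h)] at h1
    linarith

section

variable {n : ℕ} {S : Set (EuclideanSpace ℝ (Fin n))}

theorem integrableOn_of_continuous {F : Type*} [NormedAddCommGroup F]
    {f : EuclideanSpace ℝ (Fin n) → F} (hf : Continuous f) (hb : Bornology.IsBounded S) :
    IntegrableOn f S := by
  obtain ⟨r, hr⟩ := hb.subset_closedBall 0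
  exact (hf.continuousOn.integrableOn_compact (isCompact_closedBall 0 r)).mono_set hr

theorem setIntegral_apply_sub_centroid (hb : Bornology.IsBounded S) (h0 : volume S ≠ 0)
    (f : EuclideanSpace ℝ (Fin n) →L[ℝ] ℝ) : ∫ u in S, (f u - f (centroid S)) = 0 := by
  have hfin : volume S ≠ ∞ := hb.measure_lt_top.ne
  have hint : IntegrableOn (fun u : EuclideanSpace ℝ (Fin n) => u) S :=
    integrableOn_of_continuous continuous_id hb
  have hV : volume.real S ≠ 0 := by simp [Measure.real, ENNReal.toReal_eq_zero_iff, h0, hfin]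
  rw [integral_sub (f.integrable_comp hint) (integrableOn_const hfin), setIntegral_const,
    f.integral_comp_comm hint, centroid, map_smul, smul_smul, mul_inv_cancel₀ hV, one_smul,
    sub_self]

/-- A functional strictly separating the centroid from `S` would have a one-signed deviation with
zero integral. -/
theorem centroid_mem (hS : IsOpen S) (hc : Convex ℝ S) (hb : Bornology.IsBounded S)
    (h0 : volume S ≠ 0) : centroid S ∈ S := by
  by_contra hcon
  obtain ⟨f, hf⟩ := geometric_hahn_banach_open_point hc hS hcon
  have h1 := setIntegral_apply_sub_centroid hb h0 f
  have hfin : volume S ≠ ∞ := hb.measure_lt_top.ne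
  have hint : IntegrableOn (fun u => f (centroid S) - f u) S :=
    integrableOn_of_continuous (by fun_prop) hb
  have h2 : 0 < ∫ u in S, (f (centroid S) - f u) := by
    rw [setIntegral_pos_iff_support_of_nonneg_ae _ hint]
    · refine (pos_iff_ne_zero.2 h0).trans_le (measure_mono fun u hu => ⟨?_, hu⟩)
      simpa using (sub_pos.2 (hf u hu)).ne'
    · exact (ae_restrict_iff' hS.measurableSet).2 (.of_forall fun u hu => (sub_pos.2 (hf u hu)).le)
  have h3 : ∫ u in S, (f (centroid S) - f u) = - ∫ u in S, (f u - f (centroid S)) := by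
    rw [← integral_neg]
    simp
  rw [h3, h1] at h2
  simp at h2

/-- The volume of the part of `S` in the half-space `⟪θ, u⟫ ≥ s`. -/
def tailVolume (S : Set (EuclideanSpace ℝ (Fin n))) (θ : EuclideanSpace ℝ (Fin n)) (s : ℝ) : ℝ :=
  volume.real (S ∩ {u | s ≤ ⟪θ, u⟫_ℝ})

variable {θ : EuclideanSpace ℝ (Fin n)}

theorem measurableSet_halfspace (s : ℝ) : MeasurableSet {u | s ≤ ⟪θ, u⟫_ℝ} :=
  (isClosed_le continuous_const (by fun_prop)).measurableSet

theorem ofReal_tailVolume (hb : Bornology.IsBounded S) (s : ℝ) :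
    ENNReal.ofReal (tailVolume S θ s) = volume (S ∩ {u | s ≤ ⟪θ, u⟫_ℝ}) :=
  ENNReal.ofReal_toReal (hb.subset inter_subset_left).measure_lt_top.ne

theorem tailVolume_antitone (hb : Bornology.IsBounded S) : Antitone (tailVolume S θ) :=
  fun _ _ hst => measureReal_mono (inter_subset_inter_right _ fun _ hu => hst.trans hu)
    (hb.subset inter_subset_left).measure_lt_top.ne

theorem tailVolume_le (hb : Bornology.IsBounded S) (s : ℝ) : tailVolume S θ s ≤ volume.real S :=
  measureReal_mono inter_subset_left hb.measure_lt_top.ne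

/-- Openness leaves room to move from c along θ. The strict t makes ⟨θ, c⟩ an interior point of the
domain of the log, where a supporting line exists. -/
theorem tailVolume_pos (hS : IsOpen S) (hb : Bornology.IsBounded S) (hθ : θ ≠ 0)
    {c : EuclideanSpace ℝ (Fin n)} (hc : c ∈ S) : ∃ t > ⟪θ, c⟫_ℝ, 0 < tailVolume S θ t := by
  have h1 : Tendsto (fun r : ℝ => c + r • θ) (𝓝[>] 0) (𝓝 c) := by
    have : Continuous fun r : ℝ => c + r • θ := by fun_prop
    simpa using (this.tendsto 0).mono_left nhdsWithin_le_nhds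
  obtain ⟨r, hr, hr0⟩ := ((h1.eventually (hS.mem_nhds hc)).and self_mem_nhdsWithin).exists
  have hr0 : 0 < r := hr0
  have hθ2 : 0 < ⟪θ, θ⟫_ℝ := real_inner_self_pos.2 hθ
  have hlt : ⟪θ, c⟫_ℝ < ⟪θ, c + r • θ⟫_ℝ := by
    rw [inner_add_right, inner_smul_right]
    nlinarith [mul_pos hr0 hθ2]
  obtain ⟨t, ht1, ht2⟩ := exists_between hlt
  refine ⟨t, ht1, ENNReal.toReal_pos ?_ (hb.subset inter_subset_left).measure_lt_top.ne⟩
  have ho : IsOpen (S ∩ {u | t < ⟪θ, u⟫_ℝ}) :=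
    hS.inter (isOpen_lt continuous_const (by fun_prop))
  refine ((ho.measure_pos volume ⟨_, hr, ht2⟩).trans_le (measure_mono ?_)).ne'
  exact inter_subset_inter_right _ fun u (hu : t < _) => hu.le

theorem rpow_mul_rpow_le_tailVolume (hS : IsOpen S) (hc : Convex ℝ S)
    (hb : Bornology.IsBounded S) {s t a b : ℝ} (ha : 0 < a) (hb' : 0 < b) (hab : a + b = 1) :
    tailVolume S θ s ^ a * tailVolume S θ t ^ b ≤ tailVolume S θ (a * s + b * t) := by
  have hm : ∀ s, MeasurableSet (S ∩ {u | s ≤ ⟪θ, u⟫_ℝ}) := fun s =>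
    hS.measurableSet.inter (measurableSet_halfspace s)
  have h := volume_rpow_mul_rpow_le (hm s) (hm t) (hm (a * s + b * t)) ha hb' hab
    fun x hx y hy => ⟨hc hx.1 hy.1 ha.le hb'.le hab, by
      have h1 : s ≤ _ := hx.2
      have h2 : t ≤ _ := hy.2
      simp only [mem_ofPred_eq, inner_add_right, inner_smul_right]
      gcongr⟩
  have h0 : ∀ s, 0 ≤ tailVolume S θ s := fun s => measureReal_nonneg
  rw [← ofReal_tailVolume hb, ← ofReal_tailVolume hb, ← ofReal_tailVolume hb,
    ENNReal.ofReal_rpow_of_nonneg (h0 s) ha.le, ENNReal.ofReal_rpow_of_nonneg (h0 t) hb'.le,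
    ← ENNReal.ofReal_mul (Real.rpow_nonneg (h0 s) a)] at h
  exact (ENNReal.ofReal_le_ofReal_iff (h0 _)).1 h

theorem convexOn_neg_log_tailVolume (hS : IsOpen S) (hc : Convex ℝ S)
    (hb : Bornology.IsBounded S) :
    ConvexOn ℝ {s | 0 < tailVolume S θ s} fun s => -Real.log (tailVolume S θ s) := by
  refine convexOn_iff_forall_pos.2 ⟨convex_iff_forall_pos.2 ?_, ?_⟩ <;>
    intro s (hs : 0 < tailVolume S θ s) t (ht : 0 < tailVolume S θ t) a b ha hb' hab <;>
    have h := rpow_mul_rpow_le_tailVolume hS hc hb (θ := θ) (s := s) (t := t) ha hb' hab <;>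
    have h1 := Real.rpow_pos_of_pos hs a <;> have h2 := Real.rpow_pos_of_pos ht b
  · exact (mul_pos h1 h2).trans_le h
  · have h3 := Real.log_le_log (mul_pos h1 h2) h
    rw [Real.log_mul h1.ne' h2.ne', Real.log_rpow hs, Real.log_rpow ht] at h3
    simp only [smul_eq_mul]
    linarith

/-- A compact subset lies in the cap above its lowest point, and that cap has volume below r. No
continuity of the tail is needed. -/
theorem volume_tailVolume_lt_le (hS : IsOpen S) (hb : Bornology.IsBounded S) (r : ℝ) :
    volume (S ∩ {u | tailVolume S θ ⟪θ, u⟫_ℝ < r}) ≤ ENNReal.ofReal r := by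
  have hm : MeasurableSet (S ∩ {u | tailVolume S θ ⟪θ, u⟫_ℝ < r}) :=
    hS.measurableSet.inter (measurableSet_lt ((tailVolume_antitone hb).measurable.comp
      (by fun_prop)) measurable_const)
  rw [hm.measure_eq_iSup_isCompact]
  refine iSup₂_le fun K hK => iSup_le fun hKc => ?_
  rcases K.eq_empty_or_nonempty with rfl | hne
  · simp
  obtain ⟨x, hxK, hx⟩ := hKc.exists_isMinOn hne (f := fun u => ⟪θ, u⟫_ℝ) (by fun_prop)
  refine (measure_mono (t := S ∩ {u | ⟪θ, x⟫_ℝ ≤ ⟪θ, u⟫_ℝ}) fun u hu =>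
    ⟨(hK hu).1, hx hu⟩).trans ?_
  rw [← ofReal_tailVolume hb]
  exact ENNReal.ofReal_le_ofReal (hK hxK).2.le

/-- For u uniform in `S`, the relative cap volume at u is stochastically at least uniform on [0, 1],
so its negative logarithm has mean at most ∫ exp(-t) dt = 1. -/
theorem lintegral_neg_log_tailVolume_le (hS : IsOpen S) (hb : Bornology.IsBounded S)
    (h0 : volume S ≠ 0) :
    ∫⁻ u in S, ENNReal.ofReal (-Real.log (tailVolume S θ ⟪θ, u⟫_ℝ / volume.real S))
      ≤ volume S := by
  have hfin : volume S ≠ ∞ := hb.measure_lt_top.ne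
  have hV : 0 < volume.real S := ENNReal.toReal_pos h0 hfin
  have hm : Measurable fun u => -Real.log (tailVolume S θ ⟪θ, u⟫_ℝ / volume.real S) :=
    (((tailVolume_antitone hb).measurable.comp (by fun_prop)).div_const _).log.neg
  have hnn : ∀ u, 0 ≤ -Real.log (tailVolume S θ ⟪θ, u⟫_ℝ / volume.real S) := fun u =>
    neg_nonneg.2 (Real.log_nonpos (div_nonneg measureReal_nonneg hV.le)
      ((div_le_one hV).2 (tailVolume_le hb _)))
  rw [lintegral_eq_lintegral_meas_lt _ (.of_forall hnn) hm.aemeasurable]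
  calc ∫⁻ t in Ioi (0 : ℝ), (volume.restrict S)
        {u | t < -Real.log (tailVolume S θ ⟪θ, u⟫_ℝ / volume.real S)}
      ≤ ∫⁻ t in Ioi (0 : ℝ), ENNReal.ofReal (volume.real S * Real.exp (-t)) := by
        refine setLIntegral_mono (by fun_prop) fun t (ht : 0 < t) => ?_
        rw [Measure.restrict_apply (measurableSet_lt measurable_const hm)]
        refine le_trans (measure_mono ?_) (volume_tailVolume_lt_le (θ := θ) hS hb _)
        rintro u ⟨hu, huS⟩
        refine ⟨huS, ?_⟩
        have hu : t < -Real.log (tailVolume S θ ⟪θ, u⟫_ℝ / volume.real S) := hu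
        by_contra hcon
        have h1 : Real.exp (-t) ≤ tailVolume S θ ⟪θ, u⟫_ℝ / volume.real S := by
          rw [le_div_iff₀ hV, mul_comm]
          simpa using hcon
        have := (Real.le_log_iff_exp_le ((Real.exp_pos _).trans_le h1)).2 h1
        linarith
    _ = volume S := by
        rw [← ofReal_integral_eq_lintegral_ofReal
          ((integrableOn_exp_neg_Ioi 0).const_mul _) (.of_forall fun t => by positivity),
          integral_const_mul, integral_exp_neg_Ioi_zero, mul_one]
        exact ENNReal.ofReal_toReal hfin

/-- Grünbaum's inequality. -/
theorem exp_neg_one_mul_le_tailVolume (hS : IsOpen S) (hc : Convex ℝ S)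
    (hb : Bornology.IsBounded S) (h0 : volume S ≠ 0) :
    Real.exp (-1) * volume.real S ≤ tailVolume S θ ⟪θ, centroid S⟫_ℝ := by
  have hfin : volume S ≠ ∞ := hb.measure_lt_top.ne
  have hV : 0 < volume.real S := ENNReal.toReal_pos h0 hfin
  rcases eq_or_ne θ 0 with rfl | hθ
  · simp only [tailVolume, inner_zero_left, le_refl, ofPred_true, inter_univ]
    exact mul_le_of_le_one_left hV.le (by simp)
  have hpos : ∀ u ∈ S, 0 < tailVolume S θ ⟪θ, u⟫_ℝ := fun u hu => by
    obtain ⟨t, ht, htp⟩ := tailVolume_pos hS hb hθ hu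
    exact htp.trans_le (tailVolume_antitone hb ht.le)
  have hcS := centroid_mem hS hc hb h0
  obtain ⟨t, ht, htp⟩ := tailVolume_pos hS hb hθ hcS
  have hint : ⟪θ, centroid S⟫_ℝ ∈ interior {s | 0 < tailVolume S θ s} :=
    mem_interior.2 ⟨Iio t, fun s (hs : s < t) => htp.trans_le (tailVolume_antitone hb hs.le),
      isOpen_Iio, ht⟩
  obtain ⟨m, hm⟩ := (convexOn_neg_log_tailVolume hS hc hb).exists_supporting_slope hint
  set ψ := fun u => -Real.log (tailVolume S θ ⟪θ, u⟫_ℝ / volume.real S) with hψ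
  have hψm : Measurable ψ :=
    (((tailVolume_antitone hb).measurable.comp (by fun_prop)).div_const _).log.neg
  have hnn : ∀ u, 0 ≤ ψ u := fun u =>
    neg_nonneg.2 (Real.log_nonpos (div_nonneg measureReal_nonneg hV.le)
      ((div_le_one hV).2 (tailVolume_le hb _)))
  have hl := lintegral_neg_log_tailVolume_le (θ := θ) hS hb h0
  have hψi : IntegrableOn ψ S :=
    (lintegral_ofReal_ne_top_iff_integrable hψm.aestronglyMeasurable (.of_forall hnn)).1
      (hl.trans_lt hfin.lt_top).ne
  have hψV : ∫ u in S, ψ u ≤ volume.real S := by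
    rw [integral_eq_lintegral_of_nonneg_ae (.of_forall hnn) hψm.aestronglyMeasurable]
    exact ENNReal.toReal_mono hfin hl
  have hlin := setIntegral_apply_sub_centroid hb h0 (innerSL ℝ θ)
  simp only [innerSL_apply_apply] at hlin
  have hLi : IntegrableOn (fun u => ⟪θ, u⟫_ℝ - ⟪θ, centroid S⟫_ℝ) S :=
    integrableOn_of_continuous (by fun_prop) hb
  set A := ψ (centroid S) with hA
  have hAi : Integrable (fun _ => A) (volume.restrict S) := integrableOn_const hfin
  have hmi : Integrable (fun u => m * (⟪θ, u⟫_ℝ - ⟪θ, centroid S⟫_ℝ)) (volume.restrict S) :=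
    Integrable.const_mul hLi m
  -- Jensen's inequality by hand: the supporting line at the centroid bounds ψ from below, and its
  -- linear part integrates to zero.
  have h1 : ∫ u in S, (A + m * (⟪θ, u⟫_ℝ - ⟪θ, centroid S⟫_ℝ)) ≤ ∫ u in S, ψ u := by
    refine setIntegral_mono_on (hAi.add hmi) hψi
      hS.measurableSet fun u hu => ?_
    have := hm _ (hpos u hu)
    rw [hA]
    simp only [hψ]
    rw [Real.log_div (hpos u hu).ne' hV.ne', Real.log_div (hpos _ hcS).ne' hV.ne']
    linarith
  rw [integral_add hAi hmi, integral_const_mul, hlin,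
    setIntegral_const, smul_eq_mul, mul_zero, add_zero] at h1
  have h2 : A ≤ 1 := le_of_mul_le_mul_left (by linarith) hV
  have h3 : -1 ≤ Real.log (tailVolume S θ ⟪θ, centroid S⟫_ℝ / volume.real S) := by
    simp only [hA, hψ] at h2
    linarith
  rw [Real.le_log_iff_exp_le (div_pos (hpos _ hcS) hV), le_div_iff₀ hV] at h3
  exact h3

theorem volume_setOf_inner_eq_zero {a : EuclideanSpace ℝ (Fin n)} (ha : a ≠ 0) :
    volume {u | ⟪a, u⟫_ℝ = 0} = 0 := by
  have h := Measure.addHaar_submodule volume (ℝ ∙ a)ᗮ (by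
    intro h
    have : a ∈ (ℝ ∙ a)ᗮ := h ▸ Submodule.mem_top
    rw [Submodule.mem_orthogonal_singleton_iff_inner_right, inner_self_eq_zero] at this
    exact ha this)
  refine measure_mono_null (fun u hu => ?_) h
  exact Submodule.mem_orthogonal_singleton_iff_inner_right.2 hu

/-- Convex sets have null frontier; this carries the results for open sets over to the sets met by
the algorithm. -/
theorem interior_ae_eq (hc : Convex ℝ S) : interior S =ᵐ[volume] S :=
  interior_ae_eq_of_null_frontier (hc.addHaar_frontier volume)

theorem centroid_interior (hc : Convex ℝ S) : centroid (interior S) = centroid S := by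
  rw [centroid, centroid, setIntegral_congr_set (interior_ae_eq hc),
    measureReal_congr (interior_ae_eq hc)]

theorem centroid_mem_of_convex (hc : Convex ℝ S) (hb : Bornology.IsBounded S)
    (h0 : volume S ≠ 0) : centroid S ∈ S := by
  rw [← centroid_interior hc]
  refine interior_subset (centroid_mem isOpen_interior hc.interior (hb.subset interior_subset) ?_)
  rwa [measure_congr (interior_ae_eq hc)]

/-- A half-space avoiding the centroid in its interior cuts off a constant fraction. -/
theorem volume_inter_halfspace_le (hc : Convex ℝ S) (hb : Bornology.IsBounded S)
    (h0 : volume S ≠ 0) {a : EuclideanSpace ℝ (Fin n)} (ha : a ≠ 0)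
    (hca : ⟪centroid S, a⟫_ℝ ≤ 0) :
    volume.real (S ∩ {u | 0 ≤ ⟪u, a⟫_ℝ}) ≤ (1 - Real.exp (-1)) * volume.real S := by
  have hbT := hb.subset interior_subset
  have h1 := exp_neg_one_mul_le_tailVolume (θ := -a) isOpen_interior hc.interior hbT
    (by rwa [measure_congr (interior_ae_eq hc)])
  rw [centroid_interior hc, measureReal_congr (interior_ae_eq hc)] at h1
  have hH : MeasurableSet {u : EuclideanSpace ℝ (Fin n) | 0 ≤ ⟪u, a⟫_ℝ} :=
    (isClosed_le continuous_const (by fun_prop)).measurableSet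
  have h2 := measureReal_inter_add_sdiff (μ := volume) (s := S) hH hb.measure_lt_top.ne
  -- The Grünbaum cap in direction -a misses the half-space except possibly on the null hyperplane
  -- ⟪a, u⟫ = 0.
  have h3 : tailVolume (interior S) (-a) ⟪-a, centroid S⟫_ℝ
      ≤ volume.real (S \ {u | 0 ≤ ⟪u, a⟫_ℝ}) := by
    refine ENNReal.toReal_mono (hb.subset sdiff_subset).measure_lt_top.ne ?_
    calc volume (interior S ∩ {u | ⟪-a, centroid S⟫_ℝ ≤ ⟪-a, u⟫_ℝ})
        ≤ volume (S \ {u | 0 ≤ ⟪u, a⟫_ℝ} ∪ {u | ⟪a, u⟫_ℝ = 0}) := by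
          refine measure_mono ?_
          rintro u ⟨hu, huc⟩
          have huc : ⟪-a, centroid S⟫_ℝ ≤ ⟪-a, u⟫_ℝ := huc
          rw [inner_neg_left, inner_neg_left, real_inner_comm, real_inner_comm u a] at huc
          by_cases h : 0 ≤ ⟪u, a⟫_ℝ
          · right
            change ⟪a, u⟫_ℝ = 0
            rw [real_inner_comm]
            linarith
          · exact .inl ⟨interior_subset hu, h⟩
      _ ≤ _ := (measure_union_le _ _).trans (by rw [volume_setOf_inner_eq_zero ha, add_zero])
  linarith

end

/-! ### Bregman divergences and projections of steep functions -/

section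

variable {d : ℕ} {A : Set (EuclideanSpace ℝ (Fin d))} {φ : EuclideanSpace ℝ (Fin d) → ℝ} {μ : ℝ}

theorem hasDerivAt_along_line {f : EuclideanSpace ℝ (Fin d) → ℝ} {g x h : EuclideanSpace ℝ (Fin d)}
    {t : ℝ} (hf : HasGradientAt f g (x + t • h)) :
    HasDerivAt (fun s : ℝ => f (x + s • h)) ⟪g, h⟫_ℝ t := by
  have h1 : HasDerivAt (fun s : ℝ => x + s • h) h t := by
    simpa using ((hasDerivAt_id t).smul_const h).const_add x
  have h2 := hf.hasFDerivAt.comp_hasDerivAt t h1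
  rw [InnerProductSpace.toDual_apply_apply] at h2
  exact h2

theorem IsLegendre.hasGradientAt (hφ : IsLegendre A φ) {z : EuclideanSpace ℝ (Fin d)}
    (hz : z ∈ interior A) : HasGradientAt φ (∇ φ z) z :=
  (hφ.differentiableOn.differentiableAt (isOpen_interior.mem_nhds hz)).hasGradientAt

/-- Divide strong convexity on the segment from z to u by t and let t tend to 0 from the right; u
may lie on the boundary. -/
theorem bregman_ge (hφ : IsLegendre A φ) (hc : StrongConvexOn A μ φ)
    {u z : EuclideanSpace ℝ (Fin d)} (hu : u ∈ A) (hz : z ∈ interior A) :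
    μ / 2 * ‖u - z‖ ^ 2 ≤ bregman φ u z := by
  have h1 : HasDerivAt (fun s : ℝ => φ (z + s • (u - z))) ⟪∇ φ z, u - z⟫_ℝ 0 :=
    hasDerivAt_along_line (by simpa using hφ.hasGradientAt hz)
  have h2 : Tendsto (fun t : ℝ => t⁻¹ * (φ (z + t • (u - z)) - φ z)) (𝓝[>] 0)
      (𝓝 ⟪∇ φ z, u - z⟫_ℝ) := by
    simpa using h1.tendsto_slope_zero_right
  have h3 : Tendsto (fun t : ℝ => φ u - φ z - (1 - t) * (μ / 2 * ‖u - z‖ ^ 2)) (𝓝[>] 0)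
      (𝓝 (φ u - φ z - (1 - 0) * (μ / 2 * ‖u - z‖ ^ 2))) := by
    have : Continuous fun t : ℝ => φ u - φ z - (1 - t) * (μ / 2 * ‖u - z‖ ^ 2) := by fun_prop
    exact (this.tendsto 0).mono_left nhdsWithin_le_nhds
  have h4 := le_of_tendsto_of_tendsto h2 h3 (by
    filter_upwards [Ioo_mem_nhdsGT (zero_lt_one' ℝ)] with t ht
    have h5 := hc.2 (interior_subset hz) hu (sub_nonneg.2 ht.2.le) ht.1.le (sub_add_cancel 1 t)
    have e : (1 - t) • z + t • u = z + t • (u - z) := by module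
    rw [e, norm_sub_rev] at h5
    simp only [smul_eq_mul] at h5
    rw [inv_mul_le_iff₀ ht.1]
    nlinarith)
  rw [bregman]
  linarith

theorem bregman_nonneg (hφ : IsLegendre A φ) (hc : StrongConvexOn A μ φ) (hμ : 0 < μ)
    {u z : EuclideanSpace ℝ (Fin d)} (hu : u ∈ A) (hz : z ∈ interior A) : 0 ≤ bregman φ u z :=
  le_trans (by positivity) (bregman_ge hφ hc hu hz)

theorem bregman_sub_bregman (x y z : EuclideanSpace ℝ (Fin d)) :
    bregman φ x z - bregman φ y z = ⟪∇ φ y - ∇ φ z, x - y⟫_ℝ + bregman φ x y := by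
  simp only [bregman, inner_sub_left, inner_sub_right]
  ring

theorem bregman_combo_le (hc : StrongConvexOn A μ φ) (hμ : 0 < μ)
    {u x z : EuclideanSpace ℝ (Fin d)} (hu : u ∈ A) (hx : x ∈ A) {t : ℝ} (ht0 : 0 ≤ t)
    (ht1 : t ≤ 1) :
    bregman φ (u + t • (x - u)) z ≤ bregman φ u z + t * (bregman φ x z - bregman φ u z) := by
  have h5 := hc.2 hu hx (sub_nonneg.2 ht1) ht0 (sub_add_cancel 1 t)
  have e : (1 - t) • u + t • x = u + t • (x - u) := by module
  have h6 : 0 ≤ (1 - t) * t * (μ / 2 * ‖u - x‖ ^ 2) :=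
    mul_nonneg (mul_nonneg (sub_nonneg.2 ht1) ht0) (by positivity)
  rw [e] at h5
  simp only [smul_eq_mul] at h5
  simp only [bregman, inner_sub_right, inner_add_right, inner_smul_right]
  linarith

theorem hasGradientAt_bregman (hφ : IsLegendre A φ) {u : EuclideanSpace ℝ (Fin d)}
    (hu : u ∈ interior A) (z : EuclideanSpace ℝ (Fin d)) :
    HasGradientAt (fun u => bregman φ u z) (∇ φ u - ∇ φ z) u := by
  rw [hasGradientAt_iff_hasFDerivAt, map_sub]
  have h1 := ((hφ.hasGradientAt hu).hasFDerivAt.sub_const (φ z)).sub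
    (((InnerProductSpace.toDual ℝ (EuclideanSpace ℝ (Fin d))) (∇ φ z)).hasFDerivAt.comp u
      ((hasFDerivAt_id u).sub_const z))
  exact h1

theorem continuousAt_bregman (hφ : IsLegendre A φ) {u : EuclideanSpace ℝ (Fin d)}
    (hu : u ∈ interior A) (z : EuclideanSpace ℝ (Fin d)) :
    ContinuousAt (fun u => bregman φ u z) u :=
  (hasGradientAt_bregman hφ hu z).hasFDerivAt.continuousAt

theorem add_smul_sub_mem_interior (hA : Convex ℝ A) {a x : EuclideanSpace ℝ (Fin d)}
    (ha : a ∈ closure A) (hx : x ∈ interior A) {t : ℝ} (ht : t ∈ Ioc (0 : ℝ) 1) :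
    a + t • (x - a) ∈ interior A := by
  have := hA.combo_closure_interior_mem_interior ha hx (sub_nonneg.2 ht.2) ht.1
    (sub_add_cancel 1 t)
  rwa [show (1 - t) • a + t • x = a + t • (x - a) by module] at this

/-- Steepness only controls the gradient norm. Testing the tangent plane at u n at the point of a
ball around x furthest along the gradient difference g gives ⟨g, x - u n⟩ ≤ M - r‖g‖. -/
theorem tendsto_inner_gradient_atBot (hφ : IsLegendre A φ) (hc : StrongConvexOn A μ φ)
    (hμ : 0 < μ) {a x z : EuclideanSpace ℝ (Fin d)} (hz : z ∈ interior A) (ha : a ∈ frontier A)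
    (hx : x ∈ interior A) {u : ℕ → EuclideanSpace ℝ (Fin d)} (hu : ∀ n, u n ∈ interior A)
    (hlim : Tendsto u atTop (𝓝 a)) :
    Tendsto (fun n => ⟪∇ φ (u n) - ∇ φ z, x - u n⟫_ℝ) atTop atBot := by
  obtain ⟨r, hr, hrA⟩ := Metric.nhds_basis_closedBall.mem_iff.1 (isOpen_interior.mem_nhds hx)
  obtain ⟨M, hM⟩ := (isCompact_closedBall x r).bddAbove_image
    (f := fun u => bregman φ u z) fun v hv => (continuousAt_bregman hφ (hrA hv) z).continuousWithinAt
  have h1 : Tendsto (fun n => ‖∇ φ (u n) - ∇ φ z‖) atTop atTop := by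
    refine tendsto_atTop_mono (fun n => norm_sub_norm_le _ _) ?_
    exact tendsto_atTop_add_const_right _ _ (hφ.steep u a hu ha hlim)
  have h2 : Tendsto (fun n => M - r * ‖∇ φ (u n) - ∇ φ z‖) atTop atBot :=
    tendsto_atBot_add_const_left _ M (tendsto_neg_atTop_atBot.comp (h1.const_mul_atTop hr))
  refine tendsto_atBot_mono (fun n => ?_) h2
  set g := ∇ φ (u n) - ∇ φ z with hg
  set y := x + (r * ‖g‖⁻¹) • g with hy
  have hyb : y ∈ Metric.closedBall x r := by
    rw [mem_closedBall_iff_norm, hy, add_sub_cancel_left, norm_smul, norm_mul, norm_inv, norm_norm,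
      Real.norm_of_nonneg hr.le, mul_assoc]
    exact mul_le_of_le_one_right hr.le inv_mul_le_one
  have h3 : bregman φ y z ≤ M := hM ⟨y, hyb, rfl⟩
  have h4 := bregman_sub_bregman (φ := φ) y (u n) z
  have h5 := bregman_nonneg hφ hc hμ (interior_subset (hrA hyb)) (hu n)
  have h6 := bregman_nonneg hφ hc hμ (interior_subset (hu n)) hz
  have h7 : ⟪g, y - u n⟫_ℝ = ⟪g, x - u n⟫_ℝ + r * ‖g‖ := by
    rw [hy, add_sub_right_comm, inner_add_right, inner_smul_right, real_inner_self_eq_norm_sq]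
    congr 1
    rcases eq_or_ne ‖g‖ 0 with h | h
    · simp [h]
    · field_simp
  rw [← hg, h7] at h4
  linarith

/-- A steep function does not attain its minimum along a ray entering from the boundary. -/
theorem not_frontier_of_bregman_le (hφ : IsLegendre A φ) (hc : StrongConvexOn A μ φ) (hμ : 0 < μ)
    {a x z : EuclideanSpace ℝ (Fin d)} (hz : z ∈ interior A) (hx : x ∈ interior A) {m C : ℝ}
    (h1 : ∀ t ∈ Ioc (0 : ℝ) 1, m ≤ bregman φ (a + t • (x - a)) z)
    (h2 : ∀ t ∈ Ioc (0 : ℝ) 1, bregman φ (a + t • (x - a)) z ≤ m + t * C) : a ∉ frontier A := by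
  intro ha
  have hint : ∀ t ∈ Ioc (0 : ℝ) 1, a + t • (x - a) ∈ interior A := fun t ht =>
    add_smul_sub_mem_interior hφ.convex_dom (frontier_subset_closure ha) hx ht
  have ht : ∀ n : ℕ, 1 / ((n : ℝ) + 1) ∈ Ioc (0 : ℝ) 1 := fun n =>
    ⟨by positivity, by rw [div_le_one (by positivity)]; linarith [n.cast_nonneg (α := ℝ)]⟩
  have hlim : Tendsto (fun n : ℕ => a + (1 / ((n : ℝ) + 1)) • (x - a)) atTop (𝓝 a) := by
    simpa using (tendsto_one_div_add_atTop_nhds_zero_nat (𝕜 := ℝ)).smul_const (x - a) |>.const_add a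
  obtain ⟨n, hn⟩ := ((tendsto_inner_gradient_atBot hφ hc hμ hz ha hx (fun n => hint _ (ht n))
    hlim).eventually_le_atBot (-1)).exists
  set t := 1 / ((n : ℝ) + 1)
  obtain ⟨ht0, ht1⟩ := ht n
  set g := ∇ φ (a + t • (x - a)) - ∇ φ z
  have e1 : x - (a + t • (x - a)) = (1 - t) • (x - a) := by module
  rw [e1, inner_smul_right] at hn
  have hγ : ⟪g, x - a⟫_ℝ ≤ -1 := by nlinarith
  -- With slope at most -1 at t, convexity gives the lower bound m + (t - s) at s, while `h2` gives
  -- m + sC. This forces t ≤ s(1 + |C|) = t/2.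
  set s := t / (2 * (1 + |C|)) with hs
  have hC : 0 < 1 + |C| := by positivity
  have hs0 : 0 < s := by positivity
  have hst : s * (1 + |C|) = t / 2 := by rw [hs]; field_simp
  have hst' : s < t := by nlinarith [abs_nonneg C]
  have hsI : s ∈ Ioc (0 : ℝ) 1 := ⟨hs0, hst'.le.trans ht1⟩
  have h4 := bregman_sub_bregman (φ := φ) (a + s • (x - a)) (a + t • (x - a)) z
  have h5 := bregman_nonneg hφ hc hμ (interior_subset (hint s hsI)) (hint t (ht n))
  rw [show a + s • (x - a) - (a + t • (x - a)) = (s - t) • (x - a) by module,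
    inner_smul_right] at h4
  have h6 := h1 t (ht n)
  have h7 := h2 s hsI
  have h8 : t - s ≤ (s - t) * ⟪g, x - a⟫_ℝ := by nlinarith
  have h9 : s * C ≤ s * |C| := by gcongr; exact le_abs_self C
  nlinarith

variable {w v z z' : EuclideanSpace ℝ (Fin d)}

theorem inner_segment_nonneg {u x : EuclideanSpace ℝ (Fin d)} (hu : 0 ≤ ⟪w, u - v⟫_ℝ)
    (hx : 0 ≤ ⟪w, x - v⟫_ℝ) {t : ℝ} (ht : t ∈ Icc (0 : ℝ) 1) :
    0 ≤ ⟪w, u + t • (x - u) - v⟫_ℝ := by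
  rw [show u + t • (x - u) - v = (1 - t) • (u - v) + t • (x - v) by module, inner_add_right,
    inner_smul_right, inner_smul_right]
  exact add_nonneg (mul_nonneg (sub_nonneg.2 ht.2) hu) (mul_nonneg ht.1 hx)

theorem IsBregmanProj.mem_interior (hφ : IsLegendre A φ) (hc : StrongConvexOn A μ φ) (hμ : 0 < μ)
    (hz : z ∈ interior A) {x : EuclideanSpace ℝ (Fin d)} (hx : x ∈ interior A)
    (hxw : 0 ≤ ⟪w, x - v⟫_ℝ) (h : IsBregmanProj A φ w v z z') : z' ∈ interior A := by
  by_contra hcon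
  refine not_frontier_of_bregman_le hφ hc hμ hz hx (a := z') (m := bregman φ z' z)
    (C := bregman φ x z - bregman φ z' z) (fun t ht => ?_)
    (fun t ht => bregman_combo_le hc hμ h.1.1 (interior_subset hx) ht.1.le ht.2)
    ⟨subset_closure h.1.1, hcon⟩
  exact h.2 ⟨interior_subset (add_smul_sub_mem_interior hφ.convex_dom (subset_closure h.1.1) hx ht),
    inner_segment_nonneg h.1.2 hxw (Ioc_subset_Icc_self ht)⟩

/-- `A` need not be closed, nor φ lower semicontinuous at its frontier, so the infimum is taken over
interior points. A minimizing sequence is bounded by strong convexity, and steepness keeps its limit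
off the frontier. Segments towards x extend minimality to boundary points of `A`. -/
theorem exists_isBregmanProj (hφ : IsLegendre A φ) (hc : StrongConvexOn A μ φ) (hμ : 0 < μ)
    (hz : z ∈ interior A) {x : EuclideanSpace ℝ (Fin d)} (hx : x ∈ interior A)
    (hxw : 0 ≤ ⟪w, x - v⟫_ℝ) : ∃ z', IsBregmanProj A φ w v z z' := by
  set f := fun u => bregman φ u z with hf
  set F := {u | u ∈ interior A ∧ 0 ≤ ⟪w, u - v⟫_ℝ} with hF
  have hFne : (f '' F).Nonempty := ⟨f x, x, ⟨hx, hxw⟩, rfl⟩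
  have hbdd : BddBelow (f '' F) := ⟨0, by
    rintro _ ⟨u, hu, rfl⟩
    exact bregman_nonneg hφ hc hμ (interior_subset hu.1) hz⟩
  obtain ⟨b, -, hblim, hb⟩ := exists_seq_tendsto_sInf hFne hbdd
  set m := sInf (f '' F) with hm
  choose u hu hub using hb
  have hmle : ∀ y ∈ F, m ≤ f y := fun y hy => csInf_le hbdd ⟨y, hy, rfl⟩
  have hflim : Tendsto (fun n => f (u n)) atTop (𝓝 m) := by simpa only [hub] using hblim
  obtain ⟨B, hB⟩ := hflim.bddAbove_range
  have hbound : ∀ n, u n ∈ Metric.closedBall z √(2 / μ * B) := fun n => by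
    rw [mem_closedBall_iff_norm]
    refine Real.le_sqrt_of_sq_le ?_
    have h1 := bregman_ge hφ hc (interior_subset (hu n).1) hz
    have h2 : f (u n) ≤ B := hB ⟨n, rfl⟩
    have h3 : μ / 2 * ‖u n - z‖ ^ 2 ≤ B := h1.trans h2
    calc ‖u n - z‖ ^ 2 = 2 / μ * (μ / 2 * ‖u n - z‖ ^ 2) := by field_simp
      _ ≤ 2 / μ * B := by gcongr
  obtain ⟨a, -, k, hk, hka⟩ := (isCompact_closedBall z _).tendsto_subseq hbound
  have hacl : a ∈ closure A := mem_closure_of_tendsto hka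
    (.of_forall fun n => interior_subset (hu (k n)).1)
  have haw : 0 ≤ ⟪w, a - v⟫_ℝ := by
    have : Continuous fun y => ⟪w, y - v⟫_ℝ := by fun_prop
    exact ge_of_tendsto' ((this.tendsto a).comp hka) fun n => (hu (k n)).2
  have hflim' := hflim.comp hk.tendsto_atTop
  have ha : a ∈ interior A := by
    by_contra hcon
    refine not_frontier_of_bregman_le hφ hc hμ hz hx (a := a) (m := m) (C := f x - m)
      (fun t ht => ?_) (fun t ht => ?_) ⟨hacl, hcon⟩
    · exact hmle _ ⟨add_smul_sub_mem_interior hφ.convex_dom hacl hx ht,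
        inner_segment_nonneg haw hxw (Ioc_subset_Icc_self ht)⟩
    · have h1 : Tendsto (fun n => f (u (k n) + t • (x - u (k n)))) atTop
          (𝓝 (f (a + t • (x - a)))) := by
        refine (continuousAt_bregman hφ
          (add_smul_sub_mem_interior hφ.convex_dom hacl hx ht) z).tendsto.comp ?_
        exact hka.add ((tendsto_const_nhds.sub hka).const_smul t)
      exact le_of_tendsto_of_tendsto h1
        (hflim'.add ((tendsto_const_nhds.sub hflim').const_mul t)) (.of_forall fun n =>
          bregman_combo_le hc hμ (interior_subset (hu (k n)).1) (interior_subset hx) ht.1.le ht.2)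
  have hfa : f a = m :=
    tendsto_nhds_unique ((continuousAt_bregman hφ ha z).tendsto.comp hka) hflim'
  refine ⟨a, ⟨interior_subset ha, haw⟩, fun y hy => ?_⟩
  change f a ≤ f y
  rw [hfa]
  have h2 : Tendsto (fun t : ℝ => f y + t * (f x - f y)) (𝓝[>] 0) (𝓝 (f y + 0 * (f x - f y))) := by
    have : Continuous fun t : ℝ => f y + t * (f x - f y) := by fun_prop
    exact (this.tendsto 0).mono_left nhdsWithin_le_nhds
  rw [zero_mul, add_zero] at h2
  refine ge_of_tendsto h2 ?_
  filter_upwards [Ioc_mem_nhdsGT (zero_lt_one' ℝ)] with t ht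
  exact (hmle _ ⟨add_smul_sub_mem_interior hφ.convex_dom (subset_closure hy.1) hx ht,
    inner_segment_nonneg hy.2 hxw (Ioc_subset_Icc_self ht)⟩).trans
    (bregman_combo_le hc hμ hy.1 (interior_subset hx) ht.1.le ht.2)

/-- First-order optimality condition for a Bregman projection. -/
theorem IsBregmanProj.inner_nonneg (hφ : IsLegendre A φ) (hz' : z' ∈ interior A)
    (h : IsBregmanProj A φ w v z z') {e : EuclideanSpace ℝ (Fin d)}
    (he : ∀ᶠ t : ℝ in 𝓝[>] 0, z' + t • e ∈ A ∧ 0 ≤ ⟪w, z' + t • e - v⟫_ℝ) :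
    0 ≤ ⟪∇ φ z' - ∇ φ z, e⟫_ℝ := by
  have h1 : HasDerivAt (fun s : ℝ => bregman φ (z' + s • e) z) ⟪∇ φ z' - ∇ φ z, e⟫_ℝ 0 :=
    hasDerivAt_along_line (f := fun u => bregman φ u z)
      (by simpa using hasGradientAt_bregman hφ hz' z)
  have h2 := h1.tendsto_slope_zero_right
  refine ge_of_tendsto h2 ?_
  filter_upwards [he, self_mem_nhdsWithin] with t ht (ht0 : 0 < t)
  have h3 : bregman φ z' z ≤ bregman φ (z' + t • e) z := h.2 ht
  simp only [zero_add, zero_smul, add_zero, smul_eq_mul]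
  exact mul_nonneg (inv_nonneg.2 ht0.le) (sub_nonneg.2 h3)

theorem IsBregmanProj.inner_sub_nonneg (hφ : IsLegendre A φ) (hz' : z' ∈ interior A)
    (h : IsBregmanProj A φ w v z z') {x : EuclideanSpace ℝ (Fin d)} (hx : x ∈ A)
    (hxw : 0 ≤ ⟪w, x - v⟫_ℝ) : 0 ≤ ⟪∇ φ z' - ∇ φ z, x - z'⟫_ℝ := by
  refine h.inner_nonneg hφ hz' ?_
  filter_upwards [Ioc_mem_nhdsGT (zero_lt_one' ℝ)] with t ht
  refine ⟨?_, inner_segment_nonneg h.1.2 hxw (Ioc_subset_Icc_self ht)⟩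
  exact hφ.convex_dom.add_smul_sub_mem h.1.1 hx (Ioc_subset_Icc_self ht)

theorem IsBregmanProj.bregman_le (hφ : IsLegendre A φ) (hc : StrongConvexOn A μ φ) (hμ : 0 < μ)
    (hz : z ∈ interior A) (hz' : z' ∈ interior A)
    (h : IsBregmanProj A φ w v z z') {x : EuclideanSpace ℝ (Fin d)} (hx : x ∈ A)
    (hxw : 0 ≤ ⟪w, x - v⟫_ℝ) : bregman φ x z' ≤ bregman φ x z := by
  have h1 := h.inner_sub_nonneg hφ hz' hx hxw
  have h2 := bregman_sub_bregman (φ := φ) x z' z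
  have h3 := bregman_nonneg hφ hc hμ h.1.1 hz
  linarith

/-- From the interior point z' every direction e with ⟨w, e⟩ ≥ 0 is feasible, so the gradient
difference is non-negative on a half-space and its component orthogonal to w vanishes. -/
theorem IsBregmanProj.exists_multiplier (hφ : IsLegendre A φ) (hz' : z' ∈ interior A)
    (h : IsBregmanProj A φ w v z z') : ∃ c : ℝ, 0 ≤ c ∧ ∇ φ z' - ∇ φ z = c • w := by
  set g := ∇ φ z' - ∇ φ z with hg
  have key : ∀ e, 0 ≤ ⟪w, e⟫_ℝ → 0 ≤ ⟪g, e⟫_ℝ := by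
    intro e he
    refine h.inner_nonneg hφ hz' ?_
    have h1 : Tendsto (fun t : ℝ => z' + t • e) (𝓝[>] 0) (𝓝 z') := by
      have : Continuous fun t : ℝ => z' + t • e := by fun_prop
      simpa using (this.tendsto 0).mono_left nhdsWithin_le_nhds
    filter_upwards [h1.eventually (isOpen_interior.mem_nhds hz'), self_mem_nhdsWithin]
      with t ht (ht0 : 0 < t)
    refine ⟨interior_subset ht, ?_⟩
    rw [add_sub_right_comm, inner_add_right, inner_smul_right]
    exact add_nonneg h.1.2 (mul_nonneg ht0.le he)
  refine ⟨⟪g, w⟫_ℝ / ⟪w, w⟫_ℝ, div_nonneg (key w real_inner_self_nonneg) real_inner_self_nonneg, ?_⟩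
  set c := ⟪g, w⟫_ℝ / ⟪w, w⟫_ℝ with hcdef
  have hcw : c * ⟪w, w⟫_ℝ = ⟪g, w⟫_ℝ := by
    rcases eq_or_ne w 0 with rfl | hw
    · simp
    · exact div_mul_cancel₀ _ (by simpa using hw)
  have h1 : ⟪w, g - c • w⟫_ℝ = 0 := by
    rw [inner_sub_right, inner_smul_right, hcw, real_inner_comm, sub_self]
  have h2 := key (-(g - c • w)) (by rw [inner_neg_right, h1, neg_zero])
  have h3 : ⟪g - c • w, g - c • w⟫_ℝ = ⟪g, g - c • w⟫_ℝ := by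
    rw [inner_sub_left, real_inner_smul_left, h1]
    ring
  rw [inner_neg_right, ← h3] at h2
  have h4 : ⟪g - c • w, g - c • w⟫_ℝ = 0 := le_antisymm (by linarith) real_inner_self_nonneg
  exact sub_eq_zero.1 (inner_self_eq_zero.1 h4)

/-! ### Hessians and the consequence of PNIP -/

theorem mul_norm_sq_le_inner_gradient_sub (hφ : IsLegendre A φ) (hc : StrongConvexOn A μ φ)
    (hz : z ∈ interior A) (hz' : z' ∈ interior A) :
    μ * ‖z' - z‖ ^ 2 ≤ ⟪∇ φ z' - ∇ φ z, z' - z⟫_ℝ := by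
  have h1 := bregman_ge hφ hc (interior_subset hz) hz'
  have h2 := bregman_ge hφ hc (interior_subset hz') hz
  rw [norm_sub_rev] at h1
  simp only [bregman, inner_sub_left, inner_sub_right] at *
  linarith

theorem mul_norm_sq_le_inner_hessian (hφ : IsLegendre A φ) (hc : StrongConvexOn A μ φ)
    (h2 : DifferentiableOn ℝ (∇ φ) (interior A)) {x : EuclideanSpace ℝ (Fin d)}
    (hx : x ∈ interior A) (h : EuclideanSpace ℝ (Fin d)) :
    μ * ‖h‖ ^ 2 ≤ ⟪hessian φ x h, h⟫_ℝ := by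
  have hd : HasFDerivAt (∇ φ) (hessian φ x) (x + (0 : ℝ) • h) := by
    rw [zero_smul, add_zero]
    exact (h2.differentiableAt (isOpen_interior.mem_nhds hx)).hasFDerivAt
  have h1 : HasDerivAt (fun s : ℝ => x + s • h) h 0 := by
    simpa using ((hasDerivAt_id (0 : ℝ)).smul_const h).const_add x
  have h3 := (hd.comp_hasDerivAt 0 h1).tendsto_slope_zero_right
  have h4 := h3.inner (tendsto_const_nhds (x := h)) (𝕜 := ℝ)
  refine ge_of_tendsto h4 ?_
  have h5 : Tendsto (fun t : ℝ => x + t • h) (𝓝[>] 0) (𝓝 x) := by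
    simpa using h1.continuousAt.tendsto.mono_left nhdsWithin_le_nhds
  filter_upwards [h5.eventually (isOpen_interior.mem_nhds hx), self_mem_nhdsWithin]
    with t ht (ht0 : 0 < t)
  have h6 := mul_norm_sq_le_inner_gradient_sub hφ hc hx ht
  rw [add_sub_cancel_left, norm_smul, inner_smul_right, Real.norm_of_nonneg ht0.le] at h6
  simp only [zero_add, zero_smul, add_zero, Function.comp, real_inner_smul_left]
  rw [inv_mul_eq_div, le_div_iff₀ ht0]
  nlinarith

theorem mul_norm_sq_le_inner_of_mem_convexHull (hφ : IsLegendre A φ) (hc : StrongConvexOn A μ φ)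
    (h2 : DifferentiableOn ℝ (∇ φ) (interior A))
    {H : EuclideanSpace ℝ (Fin d) →L[ℝ] EuclideanSpace ℝ (Fin d)}
    (hH : H ∈ convexHull ℝ (hessian φ '' interior A)) (h : EuclideanSpace ℝ (Fin d)) :
    μ * ‖h‖ ^ 2 ≤ ⟪H h, h⟫_ℝ := by
  have hconv : Convex ℝ {H : EuclideanSpace ℝ (Fin d) →L[ℝ] EuclideanSpace ℝ (Fin d) |
      μ * ‖h‖ ^ 2 ≤ ⟪H h, h⟫_ℝ} := by
    intro H hH H' hH' a b ha hb hab
    have hH : μ * ‖h‖ ^ 2 ≤ ⟪H h, h⟫_ℝ := hH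
    have hH' : μ * ‖h‖ ^ 2 ≤ ⟪H' h, h⟫_ℝ := hH'
    change μ * ‖h‖ ^ 2 ≤ ⟪(a • H + b • H') h, h⟫_ℝ
    simp only [add_apply, smul_apply, inner_add_left,
      real_inner_smul_left]
    calc μ * ‖h‖ ^ 2 = a * (μ * ‖h‖ ^ 2) + b * (μ * ‖h‖ ^ 2) := by rw [← add_mul, hab, one_mul]
      _ ≤ _ := by gcongr
  refine convexHull_min ?_ hconv hH
  rintro _ ⟨x, hx, rfl⟩
  exact mul_norm_sq_le_inner_hessian hφ hc h2 hx h

/-- Bounds the inverses uniformly by 1/μ over the hull, which controls the error in the mean value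
argument. -/
theorem mul_norm_le_of_mem_convexHull (hφ : IsLegendre A φ) (hc : StrongConvexOn A μ φ)
    (h2 : DifferentiableOn ℝ (∇ φ) (interior A))
    {H : EuclideanSpace ℝ (Fin d) →L[ℝ] EuclideanSpace ℝ (Fin d)}
    (hH : H ∈ convexHull ℝ (hessian φ '' interior A)) (h : EuclideanSpace ℝ (Fin d)) :
    μ * ‖h‖ ≤ ‖H h‖ := by
  have h1 := (mul_norm_sq_le_inner_of_mem_convexHull hφ hc h2 hH h).trans (real_inner_le_norm _ _)
  rcases (norm_nonneg h).eq_or_lt with h0 | h0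
  · rw [← h0]
    simp
  · exact le_of_mul_le_mul_right (by linarith) h0

/-- The Hessian is not assumed continuous or integrable, so it is not averaged along the segment: a
separating functional would contradict the scalar mean value theorem. -/
theorem gradient_sub_mem_closure (hφ : IsLegendre A φ)
    (h2 : DifferentiableOn ℝ (∇ φ) (interior A)) (hz : z ∈ interior A) (hz' : z' ∈ interior A) :
    ∇ φ z' - ∇ φ z ∈ closure ((fun H : EuclideanSpace ℝ (Fin d) →L[ℝ] EuclideanSpace ℝ (Fin d) =>
      H (z' - z)) '' convexHull ℝ (hessian φ '' interior A)) := by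
  set h := z' - z with hh
  by_contra hcon
  have hconv : Convex ℝ (closure ((fun H : EuclideanSpace ℝ (Fin d) →L[ℝ]
      EuclideanSpace ℝ (Fin d) => H h) '' convexHull ℝ (hessian φ '' interior A))) :=
    ((convex_convexHull ℝ _).is_linear_image
      (f := fun H : EuclideanSpace ℝ (Fin d) →L[ℝ] EuclideanSpace ℝ (Fin d) => H h)
      ⟨fun _ _ => rfl, fun _ _ => rfl⟩).closure
  obtain ⟨l, u, hl, hu⟩ := geometric_hahn_banach_closed_point hconv isClosed_closure hcon
  have hseg : ∀ t ∈ Icc (0 : ℝ) 1, z + t • h ∈ interior A := fun t ht =>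
    hφ.convex_dom.interior.add_smul_sub_mem hz hz' ht
  have hder : ∀ t ∈ Icc (0 : ℝ) 1, HasDerivAt (fun s : ℝ => l (∇ φ (z + s • h)))
      (l (hessian φ (z + t • h) h)) t := by
    intro t ht
    have hd : HasFDerivAt (∇ φ) (hessian φ (z + t • h)) (z + t • h) :=
      (h2.differentiableAt (isOpen_interior.mem_nhds (hseg t ht))).hasFDerivAt
    have h1 : HasDerivAt (fun s : ℝ => z + s • h) h t := by
      simpa using ((hasDerivAt_id t).smul_const h).const_add z
    have hd' := hd.comp_hasDerivAt t h1
    exact l.hasFDerivAt.comp_hasDerivAt t hd'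
  obtain ⟨t, ht, htd⟩ := exists_hasDerivAt_eq_slope (fun s : ℝ => l (∇ φ (z + s • h)))
    (fun t => l (hessian φ (z + t • h) h)) zero_lt_one
    (fun t ht => (hder t ht).continuousAt.continuousWithinAt)
    fun t ht => hder t (Ioo_subset_Icc_self ht)
  have h3 := hl _ (subset_closure ⟨hessian φ (z + t • h),
    subset_convexHull ℝ _ ⟨_, hseg t (Ioo_subset_Icc_self ht), rfl⟩, rfl⟩)
  simp only [one_smul, zero_smul, add_zero, sub_zero, div_one] at htd
  rw [htd, hh, add_sub_cancel, ← map_sub] at h3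
  exact lt_asymm h3 hu

/-- If c w = H h held exactly, then h = c H⁻¹ w and PNIP would finish. An error δ in H h costs at
most ‖w'‖ δ/μ, which tends to 0. -/
theorem PNIP.inner_sub_nonneg {W : PointedCone ℝ (EuclideanSpace ℝ (Fin d))} (hφ : PNIP A φ W)
    (hc : StrongConvexOn A μ φ) (hμ : 0 < μ) (hz : z ∈ interior A) (hz' : z' ∈ interior A)
    (hw : w ∈ W) {c : ℝ} (hc0 : 0 ≤ c) (hg : ∇ φ z' - ∇ φ z = c • w)
    {w' : EuclideanSpace ℝ (Fin d)} (hw' : w' ∈ W) : 0 ≤ ⟪w', z' - z⟫_ℝ := by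
  have hmem := gradient_sub_mem_closure hφ.legendre hφ.twice_differentiable hz hz'
  set h := z' - z with hh
  rw [hg] at hmem
  have key : ∀ δ > 0, -(‖w'‖ * (δ / μ)) ≤ ⟪w', h⟫_ℝ := by
    intro δ hδ
    obtain ⟨_, ⟨H, hH, rfl⟩, hdist⟩ := Metric.mem_closure_iff.1 hmem δ hδ
    obtain ⟨e, he⟩ := hφ.invertible H hH
    have hinv : ∀ x, H (H.inverse x) = x := fun x => by
      rw [← he, ContinuousLinearMap.inverse_equiv]
      simp
    have hinv' : ∀ x, H.inverse (H x) = x := fun x => by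
      rw [← he, ContinuousLinearMap.inverse_equiv]
      simp
    have e1 : h = c • H.inverse w + H.inverse (H h - c • w) := by
      rw [map_sub, map_smul, hinv', add_sub_cancel]
    have h1 := hφ.nonneg H hH w' hw' w hw
    have h3 := mul_norm_le_of_mem_convexHull hφ.legendre hc hφ.twice_differentiable hH
      (H.inverse (H h - c • w))
    rw [hinv] at h3
    have h4 : ‖H.inverse (H h - c • w)‖ ≤ δ / μ := by
      rw [le_div_iff₀ hμ, mul_comm]
      rw [dist_comm, dist_eq_norm] at hdist
      exact h3.trans hdist.le
    rw [e1, inner_add_right, inner_smul_right]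
    have h5 := neg_le_of_abs_le ((abs_real_inner_le_norm w' (H.inverse (H h - c • w))).trans
      (mul_le_mul_of_nonneg_left h4 (norm_nonneg w')))
    linarith [mul_nonneg hc0 h1]
  have hlim : Tendsto (fun δ : ℝ => -(‖w'‖ * (δ / μ))) (𝓝[>] 0) (𝓝 (-(‖w'‖ * (0 / μ)))) := by
    have : Continuous fun δ : ℝ => -(‖w'‖ * (δ / μ)) := by fun_prop
    exact (this.tendsto 0).mono_left nhdsWithin_le_nhds
  have := le_of_tendsto hlim (by filter_upwards [self_mem_nhdsWithin] with δ hδ using key δ hδ)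
  simpa using this

end

/-! ### Dual cone, optimal weights and the volume of the certificates -/

section

variable {d : ℕ} {W : PointedCone ℝ (EuclideanSpace ℝ (Fin d))}

theorem mem_closure_of_forall_innerDual {x : EuclideanSpace ℝ (Fin d)}
    (h : ∀ c ∈ ProperCone.innerDual (W : Set (EuclideanSpace ℝ (Fin d))), 0 ≤ ⟪x, c⟫_ℝ) :
    x ∈ closure (W : Set (EuclideanSpace ℝ (Fin d))) := by
  by_contra hcon
  obtain ⟨y, hy, hxy⟩ := ProperCone.hyperplane_separation' (Submodule.closure W) hcon
  have hyd : y ∈ ProperCone.innerDual (W : Set (EuclideanSpace ℝ (Fin d))) :=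
    ProperCone.mem_innerDual.2 fun u hu => hy u (subset_closure hu)
  exact absurd (h y hyd) (not_le.2 hxy)

theorem inner_nonneg_of_mem_closure {x c : EuclideanSpace ℝ (Fin d)}
    (hx : x ∈ closure (W : Set (EuclideanSpace ℝ (Fin d))))
    (hc : c ∈ ProperCone.innerDual (W : Set (EuclideanSpace ℝ (Fin d)))) : 0 ≤ ⟪x, c⟫_ℝ :=
  closure_minimal (s := (W : Set (EuclideanSpace ℝ (Fin d)))) (t := {x | 0 ≤ ⟪x, c⟫_ℝ})
    (fun _ hu => ProperCone.mem_innerDual.1 hc hu)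
    (isClosed_le continuous_const (by fun_prop)) hx

/-- The set of points dominated by a convex combination of `v`. -/
def dominatedSet (W : PointedCone ℝ (EuclideanSpace ℝ (Fin d))) {k : ℕ}
    (v : Fin k → EuclideanSpace ℝ (Fin d)) : Set (EuclideanSpace ℝ (Fin d)) :=
  (fun q : Fin k → ℝ => ∑ i, q i • v i) '' stdSimplex ℝ (Fin k) +
    (ProperCone.innerDual (W : Set (EuclideanSpace ℝ (Fin d))) : Set (EuclideanSpace ℝ (Fin d)))

variable {k : ℕ} {v : Fin k → EuclideanSpace ℝ (Fin d)} {z : EuclideanSpace ℝ (Fin d)}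

theorem mem_dominatedSet {x : EuclideanSpace ℝ (Fin d)} :
    x ∈ dominatedSet W v ↔ ∃ q ∈ stdSimplex ℝ (Fin k),
      ∃ b ∈ ProperCone.innerDual (W : Set (EuclideanSpace ℝ (Fin d))), ∑ i, q i • v i + b = x := by
  simp [dominatedSet, Set.mem_add]

theorem convex_dominatedSet : Convex ℝ (dominatedSet W v) := by
  refine ((convex_stdSimplex ℝ (Fin k)).is_linear_image ⟨fun p q => ?_, fun c p => ?_⟩).add
    (ProperCone.convex _)
  · simp [add_smul, Finset.sum_add_distrib]
  · simp [mul_smul, Finset.smul_sum]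

theorem isClosed_dominatedSet : IsClosed (dominatedSet W v) :=
  (ProperCone.isClosed _).add_left_of_isCompact
    ((isCompact_stdSimplex ℝ (Fin k)).image (by fun_prop))

theorem exists_isOptimalWeights (hk : 0 < k) : ∃ p, IsOptimalWeights W z v p := by
  have hne : (dominatedSet W v).Nonempty :=
    ⟨_, mem_dominatedSet.2 ⟨_, single_mem_stdSimplex ℝ ⟨0, hk⟩, 0, zero_mem _, rfl⟩⟩
  obtain ⟨x, hx, hmin⟩ := exists_norm_eq_iInf_of_complete_convex hne
    isClosed_dominatedSet.isComplete convex_dominatedSet z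
  obtain ⟨p, hp, c, hc, rfl⟩ := mem_dominatedSet.1 hx
  refine ⟨p, hp, c, hc, fun q hq b hb => ?_⟩
  rw [norm_sub_rev, hmin, norm_sub_rev]
  exact ciInf_le (f := fun w : dominatedSet W v => ‖z - w‖)
    ⟨0, by rintro _ ⟨u, rfl⟩; exact norm_nonneg _⟩ ⟨_, mem_dominatedSet.2 ⟨q, hq, b, hb, rfl⟩⟩

/-- The variational inequality at the nearest point x makes x - z non-negative on W°, hence in the
closure of W, and gives ⟨x - z, v_i - z⟩ ≥ ‖x - z‖². -/
theorem exists_separating_direction {p : Fin k → ℝ} {c : EuclideanSpace ℝ (Fin d)}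
    (hp : p ∈ stdSimplex ℝ (Fin k))
    (hc : c ∈ ProperCone.innerDual (W : Set (EuclideanSpace ℝ (Fin d))))
    (hmin : ∀ q ∈ stdSimplex ℝ (Fin k),
      ∀ b ∈ ProperCone.innerDual (W : Set (EuclideanSpace ℝ (Fin d))),
        ‖∑ i, p i • v i + c - z‖ ≤ ‖∑ i, q i • v i + b - z‖)
    (hpos : 0 < ‖∑ i, p i • v i + c - z‖) :
    ∃ w ∈ closure (W : Set (EuclideanSpace ℝ (Fin d))), ‖w‖ = 1 ∧
      ∀ i, ‖∑ i, p i • v i + c - z‖ ≤ ⟪w, v i - z⟫_ℝ := by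
  set x := ∑ i, p i • v i + c with hx
  have hxD : x ∈ dominatedSet W v := mem_dominatedSet.2 ⟨p, hp, c, hc, rfl⟩
  have : Nonempty (dominatedSet W v) := ⟨⟨x, hxD⟩⟩
  have hinf : ‖z - x‖ = ⨅ w : dominatedSet W v, ‖z - w‖ := by
    refine le_antisymm (le_ciInf fun w => ?_) (ciInf_le
      (f := fun w : dominatedSet W v => ‖z - w‖)
      ⟨0, by rintro _ ⟨u, rfl⟩; exact norm_nonneg _⟩ ⟨x, hxD⟩)
    obtain ⟨q, hq, b, hb, hqb⟩ := mem_dominatedSet.1 w.2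
    rw [norm_sub_rev, norm_sub_rev z, ← hqb]
    exact hmin q hq b hb
  have hvar := (norm_eq_iInf_iff_real_inner_le_zero convex_dominatedSet hxD).1 hinf
  have hvar' : ∀ u ∈ dominatedSet W v, 0 ≤ ⟪x - z, u - x⟫_ℝ := fun u hu => by
    rw [← neg_sub z x, inner_neg_left]
    linarith [hvar u hu]
  set r := ‖x - z‖ with hr
  refine ⟨r⁻¹ • (x - z), mem_closure_of_forall_innerDual fun b hb => ?_, ?_, fun i => ?_⟩
  · have h1 := hvar' (x + b) (mem_dominatedSet.2 ⟨p, hp, c + b, add_mem hc hb, by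
      rw [hx, add_assoc]⟩)
    rw [add_sub_cancel_left] at h1
    rw [real_inner_smul_left]
    exact mul_nonneg (inv_nonneg.2 hpos.le) h1
  · rw [norm_smul, norm_inv, hr, norm_norm]
    exact inv_mul_cancel₀ hpos.ne'
  · have h1 := hvar' (v i) (mem_dominatedSet.2 ⟨_, single_mem_stdSimplex ℝ i, 0, zero_mem _, by
      simp [Pi.single_apply, ite_smul]⟩)
    have h2 : ⟪x - z, v i - z⟫_ℝ = ⟪x - z, v i - x⟫_ℝ + r ^ 2 := by
      rw [hr, ← real_inner_self_eq_norm_sq, ← inner_add_right, sub_add_sub_cancel]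
    rw [real_inner_smul_left, inv_mul_eq_div, le_div_iff₀ hpos, h2]
    nlinarith

/-- The apex 0 is a limit of interior points, so the interior of the cone meets the unit ball. -/
theorem volume_ne_zero_of_interior_nonempty
    (hW : (interior (W : Set (EuclideanSpace ℝ (Fin d)))).Nonempty) :
    volume ((W : Set (EuclideanSpace ℝ (Fin d))) ∩ Metric.closedBall 0 1) ≠ 0 := by
  have hcl : (0 : EuclideanSpace ℝ (Fin d)) ∈
      closure (interior (W : Set (EuclideanSpace ℝ (Fin d)))) := by
    rw [W.convex.closure_interior_eq_closure_of_nonempty_interior hW]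
    exact subset_closure W.zero_mem
  obtain ⟨x, hx1, hx2⟩ := mem_closure_iff.1 hcl _ Metric.isOpen_ball (Metric.mem_ball_self one_pos)
  refine (((isOpen_interior.inter Metric.isOpen_ball).measure_pos volume
    ⟨x, hx2, hx1⟩).trans_le (measure_mono ?_)).ne'
  exact inter_subset_inter interior_subset Metric.ball_subset_closedBall

/-- The points (1 - δ)w + δu gain (1 - δ)r from w and lose at most δL from u. Since w is only in the
closure of W, u is taken in the interior, at no cost in volume. -/
theorem pow_mul_volume_le {S : Set (EuclideanSpace ℝ (Fin d))} (hSb : Bornology.IsBounded S)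
    {vs : List (EuclideanSpace ℝ (Fin d))} {w : EuclideanSpace ℝ (Fin d)} {r L δ : ℝ}
    (hS : ∀ u ∈ W, ‖u‖ ≤ 1 → (∀ v ∈ vs, 0 ≤ ⟪u, v - z⟫_ℝ) → u ∈ S)
    (hw : w ∈ closure (W : Set (EuclideanSpace ℝ (Fin d)))) (hw1 : ‖w‖ = 1)
    (hr : ∀ v ∈ vs, r ≤ ⟪w, v - z⟫_ℝ) (hL : ∀ v ∈ vs, ‖v - z‖ ≤ L) (hδ : 0 < δ) (hδ1 : δ ≤ 1)
    (h : δ * L ≤ (1 - δ) * r) :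
    δ ^ d * volume.real ((W : Set (EuclideanSpace ℝ (Fin d))) ∩ Metric.closedBall 0 1)
      ≤ volume.real S := by
  have hsub : ((1 - δ) • w) +ᵥ (δ • (interior (W : Set (EuclideanSpace ℝ (Fin d))) ∩
      Metric.closedBall 0 1)) ⊆ S := by
    rintro _ ⟨_, ⟨u, ⟨huW, hu1⟩, rfl⟩, rfl⟩
    rw [mem_closedBall_zero_iff] at hu1
    refine hS _ (interior_subset (W.convex.combo_closure_interior_mem_interior hw huW
      (sub_nonneg.2 hδ1) hδ (sub_add_cancel 1 δ))) ?_ fun v hv => ?_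
    · refine (norm_add_le _ _).trans ?_
      change ‖(1 - δ) • w‖ + ‖δ • u‖ ≤ 1
      rw [norm_smul, norm_smul, hw1, Real.norm_of_nonneg (sub_nonneg.2 hδ1),
        Real.norm_of_nonneg hδ.le]
      nlinarith
    · change 0 ≤ ⟪(1 - δ) • w + δ • u, v - z⟫_ℝ
      rw [inner_add_left, real_inner_smul_left, real_inner_smul_left]
      have h1 : -L ≤ ⟪u, v - z⟫_ℝ := by
        refine neg_le_of_abs_le ((abs_real_inner_le_norm _ _).trans ?_)
        exact (mul_le_of_le_one_left (norm_nonneg _) hu1).trans (hL v hv)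
      have h2 := mul_le_mul_of_nonneg_left (hr v hv) (sub_nonneg.2 hδ1)
      have h3 := mul_le_mul_of_nonneg_left h1 hδ.le
      linarith
  have hvol := measure_mono (μ := volume) hsub
  rw [measure_vadd, Measure.addHaar_smul, measure_congr
    ((interior_ae_eq W.convex).inter (ae_eq_refl (Metric.closedBall 0 1))),
    finrank_euclideanSpace_fin, abs_of_pos (by positivity)] at hvol
  have h4 := ENNReal.toReal_mono hSb.measure_lt_top.ne hvol
  rwa [ENNReal.toReal_mul, ENNReal.toReal_ofReal (by positivity)] at h4

theorem pow_lt_pow_of_log_le {d k : ℕ} (hd : 0 < d) {δ : ℝ} (hδ : 0 < δ) (hδ1 : δ < 1)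
    (hk : 5 * d * Real.log δ⁻¹ ≤ k) : (1 - Real.exp (-1)) ^ k < δ ^ d := by
  have he := Real.exp_neg_one_gt_d9
  have hq : 0 < 1 - Real.exp (-1) := by
    have : Real.exp (-1) < 1 := by simp
    linarith
  -- Source of the constant 5, with slack: 1 - 1/e < 4/5 ≤ exp(-1/5).
  have hlog : Real.log (1 - Real.exp (-1)) < -(1 / 5) := by
    rw [Real.log_lt_iff_lt_exp hq]
    have := Real.add_one_le_exp (-(1 / 5) : ℝ)
    linarith
  have hδlog := Real.log_neg hδ hδ1
  rw [Real.log_inv] at hk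
  rw [← Real.log_lt_log_iff (by positivity) (by positivity), Real.log_pow, Real.log_pow]
  have hd' : (0 : ℝ) < d := by exact_mod_cast hd
  have h0 : 0 < (d : ℝ) * -Real.log δ := mul_pos hd' (neg_pos.2 hδlog)
  nlinarith

end

/-! ### Invariant, termination and correctness of the algorithm -/

section

variable {d : ℕ} {R ε μ : ℝ} {K Kstar A : Set (EuclideanSpace ℝ (Fin d))}
  {W : PointedCone ℝ (EuclideanSpace ℝ (Fin d))} {O : W → EuclideanSpace ℝ (Fin d)}
  {φ : EuclideanSpace ℝ (Fin d) → ℝ} {y : EuclideanSpace ℝ (Fin d)} {s s' : State d}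

/-- What holds for every reachable state. -/
structure State.Invariant (K Kstar A : Set (EuclideanSpace ℝ (Fin d)))
    (W : PointedCone ℝ (EuclideanSpace ℝ (Fin d))) (φ : EuclideanSpace ℝ (Fin d) → ℝ)
    (y : EuclideanSpace ℝ (Fin d)) (s : State d) : Prop where
  mem_interior : s.z ∈ interior A
  closer : ∀ x ∈ Kstar, bregman φ x s.z ≤ bregman φ x y
  mem : ∀ v ∈ s.vs, v ∈ K
  convex : Convex ℝ s.S
  subset : s.S ⊆ (W : Set (EuclideanSpace ℝ (Fin d))) ∩ Metric.closedBall 0 1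
  mem_of_inner_nonneg : ∀ u ∈ W, ‖u‖ ≤ 1 → (∀ v ∈ s.vs, 0 ≤ ⟪u, v - s.z⟫_ℝ) → u ∈ s.S
  -- The first alternative covers a degenerate cut O w = z', which removes nothing; z then stays
  -- dominated by that v for good.
  volume_le : (∃ v ∈ s.vs, s.z - v ∈ ProperCone.innerDual (W : Set (EuclideanSpace ℝ (Fin d)))) ∨
    volume.real s.S ≤ (1 - Real.exp (-1)) ^ s.vs.length *
      volume.real ((W : Set (EuclideanSpace ℝ (Fin d))) ∩ Metric.closedBall 0 1)

theorem State.Invariant.isBounded (h : s.Invariant K Kstar A W φ y) : Bornology.IsBounded s.S :=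
  Metric.isBounded_closedBall.subset (h.subset.trans inter_subset_right)

theorem State.invariant_init (hy : y ∈ interior A) :
    (State.init W y).Invariant K Kstar A W φ y where
  mem_interior := hy
  closer _ _ := le_rfl
  mem _ hv := by simp [State.init] at hv
  convex := W.convex.inter (convex_closedBall 0 1)
  subset := subset_rfl
  mem_of_inner_nonneg u hu hu1 _ := ⟨hu, mem_closedBall_zero_iff.2 hu1⟩
  volume_le := .inr (by simp [State.init])

theorem State.Invariant.step (h : s.Invariant K Kstar A W φ y) (hφ : PNIP A φ W) (hμ : 0 < μ)
    (hc : StrongConvexOn A μ φ) (hO : IsImproperOracle K Kstar W O) (hKA : Kstar ⊆ A)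
    (hKint : (Kstar ∩ interior A).Nonempty) (hs : Step A φ W O R ε s s') :
    s'.Invariant K Kstar A W φ y := by
  obtain ⟨w, hw, hvs, hproj, hS⟩ := hs.body
  obtain ⟨x, hxK, hxA⟩ := hKint
  have hfeas : ∀ x ∈ Kstar, 0 ≤ ⟪(w : EuclideanSpace ℝ (Fin d)), x - O w⟫_ℝ := fun x hx => by
    rw [inner_sub_right]
    exact sub_nonneg.2 ((hO w).2 x hx)
  have hz' : s'.z ∈ interior A := hproj.mem_interior hφ.legendre hc hμ h.mem_interior hxA
    (hfeas x hxK)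
  obtain ⟨c, hc0, hg⟩ := hproj.exists_multiplier hφ.legendre hz'
  -- The only use of PNIP's sign condition: it preserves both old cuts and domination by an old v.
  have hmono : ∀ u ∈ W, 0 ≤ ⟪u, s'.z - s.z⟫_ℝ := fun u hu =>
    hφ.inner_sub_nonneg hc hμ h.mem_interior hz' w.2 hc0 hg hu
  have hsub : s'.S ⊆ s.S := hS ▸ inter_subset_left
  refine ⟨hz', fun x hx => ?_, fun v hv => ?_, ?_, hsub.trans h.subset, fun u hu hu1 huv => ?_, ?_⟩
  · exact (hproj.bregman_le hφ.legendre hc hμ h.mem_interior hz' (hKA hx) (hfeas x hx)).trans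
      (h.closer x hx)
  · rw [hvs, List.mem_append, List.mem_singleton] at hv
    rcases hv with hv | rfl
    · exact h.mem v hv
    · exact (hO w).1
  · rw [hS]
    refine h.convex.inter fun u hu u' hu' a b ha hb _ => ?_
    have hu : 0 ≤ ⟪u, O w - s'.z⟫_ℝ := hu
    have hu' : 0 ≤ ⟪u', O w - s'.z⟫_ℝ := hu'
    change 0 ≤ ⟪a • u + b • u', O w - s'.z⟫_ℝ
    rw [inner_add_left, real_inner_smul_left, real_inner_smul_left]
    positivity
  · rw [hS]
    refine ⟨h.mem_of_inner_nonneg u hu hu1 fun v hv => ?_, huv _ (by simp [hvs])⟩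
    have h1 := huv v (by simp [hvs, hv])
    rw [← sub_add_sub_cancel v s'.z s.z, inner_add_right]
    exact add_nonneg h1 (hmono u hu)
  · rcases h.volume_le with ⟨v, hv, hvz⟩ | hvol
    · refine .inl ⟨v, by simp [hvs, hv], ProperCone.mem_innerDual.2 fun u hu => ?_⟩
      rw [← sub_add_sub_cancel s'.z s.z v, inner_add_right]
      exact add_nonneg (hmono u hu) (ProperCone.mem_innerDual.1 hvz hu)
    rcases eq_or_ne (O w) s'.z with heq | hne
    · exact .inl ⟨O w, by simp [hvs], by rw [heq, sub_self]; exact zero_mem _⟩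
    right
    have hq : 0 ≤ 1 - Real.exp (-1) := by
      have : Real.exp (-1) ≤ 1 := by simp
      linarith
    rw [hvs, List.length_append, List.length_singleton, pow_succ', mul_assoc]
    refine le_trans ?_ (mul_le_mul_of_nonneg_left hvol hq)
    rcases eq_or_ne (volume s.S) 0 with h0 | h0
    · have h1 : volume.real s'.S = 0 := by
        rw [Measure.real, measure_mono_null hsub h0, ENNReal.toReal_zero]
      rw [h1]
      positivity
    · rw [hS]
      -- The centroid lies on the cut-off side because z' is feasible for the projection.
      refine volume_inter_halfspace_le h.convex h.isBounded h0 (sub_ne_zero.2 hne) ?_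
      rw [← hw h0, ← neg_sub, inner_neg_right]
      exact neg_nonpos.2 hproj.1.2

theorem Reachable.invariant (hφ : PNIP A φ W) (hμ : 0 < μ)
    (hc : StrongConvexOn A μ φ) (hO : IsImproperOracle K Kstar W O) (hKA : Kstar ⊆ A)
    (hKint : (Kstar ∩ interior A).Nonempty) (hy : y ∈ interior A)
    (hs : Reachable A φ W O R ε y s) : s.Invariant K Kstar A W φ y := by
  unfold Reachable at hs
  induction hs with
  | refl => exact State.invariant_init hy
  | tail _ hstep ih => exact ih.step hφ hμ hc hO hKA hKint hstep

theorem State.Invariant.exists_step (h : s.Invariant K Kstar A W φ y) (hφ : PNIP A φ W)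
    (hμ : 0 < μ) (hc : StrongConvexOn A μ φ) (hO : IsImproperOracle K Kstar W O)
    (hKint : (Kstar ∩ interior A).Nonempty) (hs : s.Continues R ε) :
    ∃ s', Step A φ W O R ε s s' := by
  obtain ⟨w, hw⟩ : ∃ w : W, volume s.S ≠ 0 → (w : EuclideanSpace ℝ (Fin d)) = centroid s.S := by
    by_cases h0 : volume s.S = 0
    · exact ⟨0, fun h => absurd h0 h⟩
    · exact ⟨⟨centroid s.S, (h.subset (centroid_mem_of_convex h.convex h.isBounded h0)).1⟩,
        fun _ => rfl⟩
  obtain ⟨x, hxK, hxA⟩ := hKint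
  obtain ⟨z', hz'⟩ := exists_isBregmanProj (w := (w : EuclideanSpace ℝ (Fin d))) (v := O w)
    hφ.legendre hc hμ h.mem_interior hxA
    (by rw [inner_sub_right]; exact sub_nonneg.2 ((hO w).2 x hxK))
  exact ⟨⟨s.vs ++ [O w], s.S ∩ {u | 0 ≤ ⟪u, O w - z'⟫_ℝ}, z'⟩, hs, w, hw, rfl, hz', rfl⟩

/-- Every x in K* has norm at most R and satisfies μ/2 ‖x - z‖² ≤ D(x, z) ≤ D(x, y). -/
theorem State.Invariant.norm_le (h : s.Invariant K Kstar A W φ y) (hφ : PNIP A φ W)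
    (hμ : 0 < μ) (hc : StrongConvexOn A μ φ) (hKA : Kstar ⊆ A) (hne : Kstar.Nonempty)
    (hKstarR : Kstar ⊆ Metric.closedBall 0 R) :
    ‖s.z‖ ≤ R + √(2 / μ * sInf ((fun x => bregman φ x y) '' Kstar)) := by
  rcases le_total ‖s.z‖ R with hle | hle
  · exact hle.trans (le_add_of_nonneg_right (Real.sqrt_nonneg _))
  rw [← sub_le_iff_le_add']
  refine Real.le_sqrt_of_sq_le ?_
  have h1 : μ / 2 * (‖s.z‖ - R) ^ 2 ≤ sInf ((fun x => bregman φ x y) '' Kstar) := by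
    refine le_csInf (hne.image _) ?_
    rintro _ ⟨x, hx, rfl⟩
    refine le_trans ?_ ((bregman_ge hφ.legendre hc (hKA hx) h.mem_interior).trans (h.closer x hx))
    have h2 : ‖s.z‖ - R ≤ ‖x - s.z‖ := by
      have h3 := norm_sub_norm_le s.z x
      rw [norm_sub_rev] at h3
      have h4 := mem_closedBall_zero_iff.1 (hKstarR hx)
      linarith
    have h5 : 0 ≤ ‖s.z‖ - R := sub_nonneg.2 hle
    gcongr
  calc (‖s.z‖ - R) ^ 2 = 2 / μ * (μ / 2 * (‖s.z‖ - R) ^ 2) := by field_simp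
    _ ≤ _ := by gcongr

theorem Reachable.length_le (hR : 0 < R) (hε : 0 < ε) (hφ : PNIP A φ W) (hμ : 0 < μ)
    (hc : StrongConvexOn A μ φ) (hO : IsImproperOracle K Kstar W O) (hKA : Kstar ⊆ A)
    (hKint : (Kstar ∩ interior A).Nonempty) (hKstarR : Kstar ⊆ Metric.closedBall 0 R)
    (hy : y ∈ interior A) (hs : Reachable A φ W O R ε y s) :
    s.vs.length ≤ ⌈5 * d * Real.log ((4 * R +
      2 * √(2 / μ * sInf ((fun x => bregman φ x y) '' Kstar))) / ε)⌉₊ := by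
  cases hs with
  | refl => simp [State.init]
  | tail hs hstep =>
    rename_i s₀
    have hinv := Reachable.invariant hφ hμ hc hO hKA hKint hy hs
    have hnorm := hinv.norm_le hφ hμ hc hKA (hKint.mono inter_subset_left) hKstarR
    obtain ⟨w, -, hvs, -⟩ := hstep.body
    -- The last state need not pass the loop test, but its predecessor did: n < a gives n + 1 ≤ ⌈a⌉.
    rw [hvs, List.length_append, List.length_singleton, Nat.succ_le_iff, Nat.lt_ceil]
    refine hstep.continues.trans_le ?_
    have h0 : 0 ≤ ‖s₀.z‖ := norm_nonneg _
    gcongr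
    linarith

theorem State.Invariant.norm_le_of_isOptimal (h : s.Invariant K Kstar A W φ y) (hd : 0 < d)
    (hKR : K ⊆ Metric.closedBall 0 R)
    (hW : (interior (W : Set (EuclideanSpace ℝ (Fin d)))).Nonempty) (hε : 0 < ε)
    (hεR : ε ≤ R) (hterm : ¬ s.Continues R ε)
    {p : Fin s.vs.length → ℝ} {c : EuclideanSpace ℝ (Fin d)}
    (hp : p ∈ stdSimplex ℝ (Fin s.vs.length))
    (hc : c ∈ ProperCone.innerDual (W : Set (EuclideanSpace ℝ (Fin d))))
    (hmin : ∀ q ∈ stdSimplex ℝ (Fin s.vs.length),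
      ∀ b ∈ ProperCone.innerDual (W : Set (EuclideanSpace ℝ (Fin d))),
        ‖∑ i, p i • s.vs.get i + c - s.z‖ ≤ ‖∑ i, q i • s.vs.get i + b - s.z‖) :
    ‖∑ i, p i • s.vs.get i + c - s.z‖ ≤ ε := by
  by_contra! hcon
  obtain ⟨w, hw, hw1, hwv⟩ := exists_separating_direction hp hc hmin (hε.trans hcon)
  have hr : ∀ v ∈ s.vs, ε ≤ ⟪w, v - s.z⟫_ℝ := fun v hv => by
    obtain ⟨i, rfl⟩ := List.get_of_mem hv
    exact hcon.le.trans (hwv i)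
  have hvol : volume.real s.S ≤ (1 - Real.exp (-1)) ^ s.vs.length *
      volume.real ((W : Set (EuclideanSpace ℝ (Fin d))) ∩ Metric.closedBall 0 1) := by
    -- A dominated z contradicts ⟨w, v - z⟩ ≥ ε.
    refine h.volume_le.resolve_left ?_
    rintro ⟨v, hv, hvz⟩
    have h1 := inner_nonneg_of_mem_closure hw hvz
    have h2 := hr v hv
    rw [← neg_sub, inner_neg_right] at h1
    linarith
  set L := R + ‖s.z‖ with hL
  have hRL : R ≤ L := le_add_of_nonneg_right (norm_nonneg _)
  have hL0 : 0 < L := by linarith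
  -- This δ is the inverse of the argument of the loop's logarithm. From ε ≤ R ≤ L follows δ ≤ 1/2,
  -- so δL = ε/2 ≤ (1 - δ)ε.
  have hδ : 0 < ε / (2 * L) := by positivity
  have hδ2 : ε / (2 * L) ≤ 1 / 2 := by
    rw [div_le_div_iff₀ (by positivity) two_pos]
    linarith
  have hlow := pow_mul_volume_le h.isBounded h.mem_of_inner_nonneg hw hw1 hr (L := L)
    (fun v hv => (norm_sub_le _ _).trans
      (add_le_add_left (mem_closedBall_zero_iff.1 (hKR (h.mem v hv))) _)) hδ (by linarith) (by
      have e1 : ε / (2 * L) * L = ε / 2 := by field_simp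
      rw [e1]
      nlinarith)
  have hV : 0 < volume.real ((W : Set (EuclideanSpace ℝ (Fin d))) ∩ Metric.closedBall 0 1) :=
    ENNReal.toReal_pos (volume_ne_zero_of_interior_nonempty hW)
      (Metric.isBounded_closedBall.subset inter_subset_right).measure_lt_top.ne
  have hlt := pow_lt_pow_of_log_le (k := s.vs.length) hd hδ (by linarith) (by
    rw [inv_div]
    exact not_lt.1 hterm)
  exact absurd (hlow.trans hvol) (not_le.2 (mul_lt_mul_of_pos_right hlt hV))

/-- Since ε ≤ R the threshold is positive, so the loop runs at least once and the simplex of weights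
is non-empty. -/
theorem length_pos_of_not_continues (hd : 0 < d) (hε : 0 < ε) (hεR : ε ≤ R)
    (hterm : ¬ s.Continues R ε) : 0 < s.vs.length := by
  have h1 : 0 < 5 * d * Real.log (2 * (R + ‖s.z‖) / ε) := by
    have hd' : (0 : ℝ) < d := by exact_mod_cast hd
    refine mul_pos (by positivity) (Real.log_pos ?_)
    rw [one_lt_div hε]
    linarith [norm_nonneg s.z]
  exact_mod_cast h1.trans_le (not_lt.1 hterm)

end

end PAD

end

theorem mainTheorem2 {d : ℕ} (hd : 0 < d)
    (R : ℝ) (hR : 0 < R)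
    (K Kstar : Set (EuclideanSpace ℝ (Fin d)))
    (hK : IsCompact K) (hKR : K ⊆ Metric.closedBall 0 R)
    (hKstar : IsCompact Kstar) (hKstarR : Kstar ⊆ Metric.closedBall 0 R)
    (W : PointedCone ℝ (EuclideanSpace ℝ (Fin d)))
    (hW : (interior (W : Set (EuclideanSpace ℝ (Fin d)))).Nonempty)
    (O : W → EuclideanSpace ℝ (Fin d)) (hO : PAD.IsImproperOracle K Kstar W O)
    (A : Set (EuclideanSpace ℝ (Fin d))) (φ : EuclideanSpace ℝ (Fin d) → ℝ)
    (hφ : PAD.PNIP A φ W)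
    (μ : ℝ) (hμ : 0 < μ) (hconv : StrongConvexOn A μ φ)
    (hKA : Kstar ⊆ A) (hKint : (Kstar ∩ interior A).Nonempty)
    (y : EuclideanSpace ℝ (Fin d)) (hy : y ∈ interior A)
    (ε : ℝ) (hε : 0 < ε) (hεR : ε ≤ R) :
    -- the algorithm never gets stuck, and its points stay where `∇φ` is defined
    (∀ s, PAD.Reachable A φ W O R ε y s →
      s.z ∈ interior A ∧ (s.Continues R ε → ∃ s', PAD.Step A φ W O R ε s s')) ∧
    -- it makes at most this many iterations
    (∀ s, PAD.Reachable A φ W O R ε y s →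
      s.vs.length ≤ ⌈5 * d * Real.log ((4 * R +
        2 * √(2 / μ * sInf ((fun x => PAD.bregman φ x y) '' Kstar))) / ε)⌉₊) ∧
    -- whenever it has stopped, the weights `p` exist and the output is correct
    (∀ s, PAD.Reachable A φ W O R ε y s → ¬ s.Continues R ε →
      (∃ p, PAD.IsOptimalWeights W s.z s.vs.get p) ∧
      ∀ p, PAD.IsOptimalWeights W s.z s.vs.get p →
        PAD.IsPADOutput K Kstar W φ y ε s.z s.vs.get p) := by
  refine ⟨fun s hs => ?_, fun s hs => PAD.Reachable.length_le hR hε hφ hμ hconv hO hKA hKint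
    hKstarR hy hs, fun s hs hterm => ?_⟩ <;>
    have hinv := PAD.Reachable.invariant hφ hμ hconv hO hKA hKint hy hs
  · exact ⟨hinv.mem_interior, hinv.exists_step hφ hμ hconv hO hKint⟩
  · refine ⟨PAD.exists_isOptimalWeights (PAD.length_pos_of_not_continues hd hε hεR hterm), ?_⟩
    rintro p ⟨hp, c, hc, hmin⟩
    exact ⟨hp, hinv.closer, fun i => hinv.mem _ (List.get_mem _ _), c, hc,
      hinv.norm_le_of_isOptimal hd hKR hW hε hεR hterm hp hc hmin⟩
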